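/- Let $k$ be a field, $n\ge 2$ and $m\ge 1$ integers, and put $l=nm$. Let $Q$ be the $n$-crown quiver, with vertex set $\mathbb Z/n$ and exactly one arrow $\alpha_i\colon i\to i+1$ for each $i\in\mathbb Z/n$. Let $kQ$ be its path algebra, $t=\sum_{i}\alpha_i\in kQ$, $I=(t^l)$ the two-sided ideal generated by $t^l$, and $B=kQ/I$. For a $k$-algebra $A$ with enveloping algebra $A^e=A\otimes_k A^{\mathrm{op}}$ and an $A$-bimodule $M$ write $H^p(A,M)=\operatorname{Ext}^p_{A^e}(A,M)$, and let $HH^*(A)=\bigoplus_{p\ge 0}H^p(A,A)$ be the Hochschild cohomology algebra of $A$ with the Yoneda product; $HH^{\mathrm{ev}}(A)$ and $HH^{\mathrm{odd}}(A)$ are its parts of even and odd degree. Let $\zeta\in HH^2(B)$ be the class of the singular extension of algebras $0\to B\to kQ/I^2\to B\to 0$, in which $B$ is identified with $I/I^2$ by right multiplication by $t^l$. View the centre $Z(B)$ as $HH^0(B)$, and regard $H^1(kQ,B)$ as a $Z(B)$-module through the action of $Z(B)$ on the coefficients $B$. Then: 1. There is an isomorphism of $k$-algebras $\Phi\colon Z(B)[X]\to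 HH^{\mathrm{ev}}(B)$, defined on the polynomial ring in one variable over $Z(B)$, with $\Phi(X)=\zeta$ and $\Phi(z)=z\in HH^0(B)$ for $z\in Z(B)$; that is, $HH^{\mathrm{ev}}(B)\cong Z(B)[\zeta]$. 2. There is an isomorphism of $HH^{\mathrm{ev}}(B)$-modules $\Psi\colon H^1(kQ,B)[\zeta]\to HH^{\mathrm{odd}}(B)$, where $H^1(kQ,B)[\zeta]=Z(B)[\zeta]\otimes_{Z(B)}H^1(kQ,B)$ is an $HH^{\mathrm{ev}}(B)$-module through $\Phi$, and $\Psi$ maps $H^1(kQ,B)$ into $HH^1(B)$. 3. The product of any two elements of $HH^{\mathrm{odd}}(B)$ is zero. Consequently $HH^*(B)\cong Z(B)[\zeta]\oplus H^1(kQ,B)[\zeta]$ as algebras, compatibly with $\Phi$ and $\Psi$, with product $(p,v)(q,w)=(pq,\;pw+qv)$ on the right-hand side. -/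

import Mathlib

open CategoryTheory CategoryTheory.Abelian TensorProduct DirectSum Polynomial

universe u v w

noncomputable section

/-! ### Path algebras of quivers with finitely many vertices -/

/-- All paths of a quiver, with source `p.1`, target `p.2.1`. -/
abbrev QuiverPath (V : Type v) [Quiver.{w} V] : Type (max v w) :=
  Σ (a : V) (b : V), Quiver.Path a b

/-- The path algebra of the quiver `V`: the `k`-vector space with basis the set of paths. -/
def PathAlgebra (k : Type u) [Field k] (V : Type v) [Quiver.{w} V] : Type (max u v w) :=
  QuiverPath V →₀ k

namespace PathAlgebra

variable (k : Type u) [Field k] (V : Type v) [Quiver.{w} V]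

instance : AddCommGroup (PathAlgebra k V) := inferInstanceAs (AddCommGroup (QuiverPath V →₀ k))
instance : Module k (PathAlgebra k V) := inferInstanceAs (Module k (QuiverPath V →₀ k))

variable {V}

/-- The basis element of the path algebra given by a path. -/
def ofPath (p : QuiverPath V) : PathAlgebra k V := Finsupp.single p (1 : k)

theorem induction_ofPath {k : Type u} [Field k] {P : PathAlgebra k V → Prop} (f : PathAlgebra k V) (h0 : P 0)
    (hadd : ∀ f g, P f → P g → P (f + g))
    (hsingle : ∀ (r : k) (p : QuiverPath V), P (r • ofPath k p)) : P f := by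
  refine Finsupp.induction_linear f h0 hadd ?_
  intro p r
  have := hsingle r p
  rw [ofPath] at this
  erw [Finsupp.smul_single, smul_eq_mul, mul_one] at this
  exact this

variable [DecidableEq V]

/-- The product of two paths, composed from right to left: `p q` is "first `q`, then `p`" if `q`
ends where `p` starts, and `0` otherwise. -/
def mulPath (p q : QuiverPath V) : PathAlgebra k V :=
  if h : q.2.1 = p.1 then ofPath k ⟨q.1, p.2.1, q.2.2.comp (p.2.2.cast h.symm rfl)⟩ else 0

/-- The bilinear extension of `mulPath`. -/
def mulLin : PathAlgebra k V →ₗ[k] PathAlgebra k V →ₗ[k] PathAlgebra k V :=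
  Finsupp.linearCombination k fun p => Finsupp.linearCombination k fun q => mulPath k p q

variable {k}

instance : Mul (PathAlgebra k V) := ⟨fun f g => mulLin k f g⟩

theorem mul_def (f g : PathAlgebra k V) : f * g = mulLin k f g := rfl

theorem ofPath_mul_ofPath (p q : QuiverPath V) :
    ofPath k p * ofPath k q = mulPath k p q := by
  rw [mul_def, mulLin, ofPath, ofPath]
  erw [Finsupp.linearCombination_single, one_smul, Finsupp.linearCombination_single, one_smul]

theorem smul_mul' (r : k) (f g : PathAlgebra k V) : (r • f) * g = r • (f * g) := by
  simp [mul_def]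

theorem mul_smul' (r : k) (f g : PathAlgebra k V) : f * (r • g) = r • (f * g) := by
  simp [mul_def]

theorem add_mul' (f g h : PathAlgebra k V) : (f + g) * h = f * h + g * h := by
  simp [mul_def]

theorem mul_add' (f g h : PathAlgebra k V) : f * (g + h) = f * g + f * h := by
  simp [mul_def]

theorem zero_mul' (f : PathAlgebra k V) : 0 * f = 0 := by simp [mul_def]

theorem mul_zero' (f : PathAlgebra k V) : f * 0 = 0 := by simp [mul_def]

theorem ofPath_mul_assoc (p q r : QuiverPath V) :
    ofPath k p * ofPath k q * ofPath k r = ofPath k p * (ofPath k q * ofPath k r) := by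
  obtain ⟨a, b, p⟩ := p
  obtain ⟨c, d, q⟩ := q
  obtain ⟨e, f, r⟩ := r
  rw [ofPath_mul_ofPath, ofPath_mul_ofPath]
  by_cases h1 : d = a <;> by_cases h2 : f = c
  · subst h1 h2
    simp [mulPath, ofPath_mul_ofPath]
  · subst h1
    simp [mulPath, ofPath_mul_ofPath, h2, mul_zero']
  · subst h2
    simp [mulPath, ofPath_mul_ofPath, h1, zero_mul']
  · simp [mulPath, h1, h2, zero_mul', mul_zero']

theorem mul_assoc' (f g h : PathAlgebra k V) : f * g * h = f * (g * h) := by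
  induction f using induction_ofPath with
  | h0 => simp only [zero_mul']
  | hadd f₁ f₂ h₁ h₂ => simp only [add_mul', h₁, h₂]
  | hsingle r p =>
    induction g using induction_ofPath with
    | h0 => simp only [zero_mul', mul_zero']
    | hadd g₁ g₂ h₁ h₂ => simp only [add_mul', mul_add', h₁, h₂]
    | hsingle s q =>
      induction h using induction_ofPath with
      | h0 => simp only [mul_zero']
      | hadd g₁ g₂ h₁ h₂ => simp only [mul_add', h₁, h₂]
      | hsingle t x => simp only [smul_mul', mul_smul', ofPath_mul_assoc]

variable [Fintype V]

/-- The unit is the sum of the trivial paths. -/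
instance : One (PathAlgebra k V) := ⟨∑ v : V, ofPath k ⟨v, v, Quiver.Path.nil⟩⟩

theorem one_mul' (f : PathAlgebra k V) : 1 * f = f := by
  induction f using induction_ofPath with
  | h0 => simp only [mul_zero']
  | hadd f₁ f₂ h₁ h₂ => simp only [mul_add', h₁, h₂]
  | hsingle r p =>
    obtain ⟨a, b, p⟩ := p
    rw [mul_smul', show (1 : PathAlgebra k V) = ∑ v : V, ofPath k ⟨v, v, Quiver.Path.nil⟩ from rfl,
      mul_def, map_sum, LinearMap.sum_apply]
    congr 1
    rw [Finset.sum_eq_single b]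
    · rw [← mul_def, ofPath_mul_ofPath]
      simp [mulPath]
    · intro c _ hc
      rw [← mul_def, ofPath_mul_ofPath]
      simp [mulPath, hc.symm]
    · simp

theorem mul_one' (f : PathAlgebra k V) : f * 1 = f := by
  induction f using induction_ofPath with
  | h0 => simp only [zero_mul']
  | hadd f₁ f₂ h₁ h₂ => simp only [add_mul', h₁, h₂]
  | hsingle r p =>
    obtain ⟨a, b, p⟩ := p
    rw [smul_mul', show (1 : PathAlgebra k V) = ∑ v : V, ofPath k ⟨v, v, Quiver.Path.nil⟩ from rfl,
      mul_def, map_sum]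
    congr 1
    rw [Finset.sum_eq_single a]
    · rw [← mul_def, ofPath_mul_ofPath]
      simp [mulPath]
    · intro c _ hc
      rw [← mul_def, ofPath_mul_ofPath]
      simp [mulPath, hc]
    · simp

instance : Ring (PathAlgebra k V) :=
  { (inferInstance : AddCommGroup (PathAlgebra k V)) with
    mul_assoc := mul_assoc'
    one_mul := one_mul'
    mul_one := mul_one'
    left_distrib := mul_add'
    right_distrib := add_mul'
    zero_mul := zero_mul'
    mul_zero := mul_zero' }

instance : Algebra k (PathAlgebra k V) :=
  Algebra.ofModule smul_mul' (fun r f g => mul_smul' r f g)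

end PathAlgebra

/-! ### Bimodules and Hochschild cohomology `H^*(A, M) = Ext_{A^e}^*(A, M)` -/

section Hochschild

variable (k : Type u) [Field k]

/-- The enveloping algebra `A^e = A ⊗ A^op`; `A`-bimodules are the objects of
`ModuleCat (Enveloping k A)`, with `(a ⊗ b) • m = a m b`. -/
abbrev Enveloping (A : Type u) [Ring A] [Algebra k A] : Type u := A ⊗[k] Aᵐᵒᵖ

/-- The regular bimodule `A`, with `(a ⊗ b) • x = a x b`. -/
def regularBimodule (A : Type u) [Ring A] [Algebra k A] : ModuleCat.{u} (Enveloping k A) :=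
  letI : Module (Enveloping k A) A := TensorProduct.Algebra.module
  ModuleCat.of (Enveloping k A) A

/-- Restriction of bimodules along an algebra morphism. -/
def restrictBimodule {A B : Type u} [Ring A] [Algebra k A] [Ring B] [Algebra k B]
    (φ : A →ₐ[k] B) : ModuleCat.{u} (Enveloping k B) ⥤ ModuleCat.{u} (Enveloping k A) :=
  ModuleCat.restrictScalars (Algebra.TensorProduct.map φ (AlgHom.op φ)).toRingHom

/-- Hochschild cohomology `H^p(A, M) = Ext_{A^e}^p(A, M)` with coefficients in a bimodule. -/
abbrev HochschildCohomology {A : Type u} [Ring A] [Algebra k A]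
    (M : ModuleCat.{u} (Enveloping k A)) (p : ℕ) : Type u :=
  Ext.{u} (regularBimodule k A) M p

/-- `HH^p(A) = H^p(A, A)`. -/
abbrev HHdeg (A : Type u) [Ring A] [Algebra k A] (p : ℕ) : Type u :=
  HochschildCohomology k (regularBimodule k A) p

variable {k}
variable {A : Type u} [Ring A] [Algebra k A]

theorem regularBimodule_tmul_smul (a b : A) (x : A) :
    (show A from (a ⊗ₜ[k] MulOpposite.op b : Enveloping k A) •
      (show regularBimodule k A from x)) = a * x * b := by
  let _ : Module (Enveloping k A) A := TensorProduct.Algebra.module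
  change (a ⊗ₜ[k] MulOpposite.op b : Enveloping k A) • x = a * x * b
  rw [TensorProduct.Algebra.smul_def]
  simp [mul_assoc]

/-- Multiplication by a central element, as an endomorphism of the regular bimodule. -/
def centerEnd (z : Subalgebra.center k A) : regularBimodule k A ⟶ regularBimodule k A :=
  letI : Module (Enveloping k A) A := TensorProduct.Algebra.module
  ModuleCat.ofHom (X := A) (Y := A)
    { toFun := fun x => (z : A) * x
      map_add' := fun x y => mul_add _ _ _
      map_smul' := fun r x => by
        induction r using TensorProduct.induction_on with
        | zero =>
          change (z : A) * ((0 : Enveloping k A) • x) = (0 : Enveloping k A) • ((z : A) * x)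
          have h0 : ∀ y : A, (0 : Enveloping k A) • y = 0 := fun y => zero_smul (Enveloping k A) y
          exact (congrArg _ (h0 x)).trans ((mul_zero _).trans (h0 _).symm)
        | add r s hr hs =>
          rw [RingHom.id_apply] at hr hs ⊢
          rw [add_smul, add_smul, mul_add, hr, hs]
        | tmul a b =>
          have hz : ∀ y : A, y * (z : A) = z * y := Subalgebra.mem_center_iff.1 z.2
          simp only [TensorProduct.Algebra.smul_def, RingHom.id_apply, MulOpposite.smul_eq_mul_unop,
            smul_eq_mul]
          rw [← mul_assoc, ← hz a, mul_assoc, mul_assoc] }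

theorem centerEnd_apply (z : Subalgebra.center k A) (x : A) :
    (show A from (centerEnd z).hom (show regularBimodule k A from x)) = (z : A) * x := rfl

theorem centerEnd_one : centerEnd (1 : Subalgebra.center k A) = 𝟙 _ := by
  refine ModuleCat.hom_ext (LinearMap.ext fun x => ?_)
  exact one_mul (show A from x)

theorem centerEnd_zero : centerEnd (0 : Subalgebra.center k A) = 0 := by
  refine ModuleCat.hom_ext (LinearMap.ext fun x => ?_)
  exact zero_mul (show A from x)

theorem centerEnd_add (y z : Subalgebra.center k A) :
    centerEnd (y + z) = centerEnd y + centerEnd z := by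
  refine ModuleCat.hom_ext (LinearMap.ext fun x => ?_)
  exact add_mul (y : A) (z : A) (show A from x)

theorem centerEnd_mul (y z : Subalgebra.center k A) :
    centerEnd (y * z) = centerEnd z ≫ centerEnd y := by
  refine ModuleCat.hom_ext (LinearMap.ext fun x => ?_)
  exact mul_assoc (y : A) (z : A) (show A from x)

/-- The class in `HH^0(A)` of a central element. -/
def centerClass (z : Subalgebra.center k A) : HHdeg k A 0 := Ext.mk₀ (centerEnd z)

/-- The usual `Z(B)`-module structure on `H^p(A, B)`, for an algebra morphism `φ : A → B`: the
central element `z` acts through the endomorphism `b ↦ z b` of the coefficients. -/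
instance centerModule {B : Type u} [Ring B] [Algebra k B] (φ : A →ₐ[k] B) (p : ℕ) :
    Module (Subalgebra.center k B)
      (HochschildCohomology k ((restrictBimodule k φ).obj (regularBimodule k B)) p) where
  smul z x := x.comp (Ext.mk₀ ((restrictBimodule k φ).map (centerEnd z))) (add_zero p)
  one_smul x := by
    change x.comp (Ext.mk₀ ((restrictBimodule k φ).map (centerEnd 1))) (add_zero p) = x
    rw [centerEnd_one, CategoryTheory.Functor.map_id, Ext.comp_mk₀_id]
  mul_smul y z x := by
    change x.comp (Ext.mk₀ ((restrictBimodule k φ).map (centerEnd (y * z)))) (add_zero p) =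
      (x.comp (Ext.mk₀ ((restrictBimodule k φ).map (centerEnd z))) (add_zero p)).comp
        (Ext.mk₀ ((restrictBimodule k φ).map (centerEnd y))) (add_zero p)
    rw [centerEnd_mul, CategoryTheory.Functor.map_comp, ← Ext.mk₀_comp_mk₀,
      Ext.comp_assoc_of_third_deg_zero]
  smul_zero z := by
    change Ext.comp 0 _ _ = _
    rw [Ext.zero_comp]
  smul_add z x y := Ext.add_comp _ _ _ _
  add_smul y z x := by
    change x.comp (Ext.mk₀ ((restrictBimodule k φ).map (centerEnd (y + z)))) (add_zero p) = _
    have : (restrictBimodule k φ).map (centerEnd (y + z)) =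
        (restrictBimodule k φ).map (centerEnd y) + (restrictBimodule k φ).map (centerEnd z) := by
      rw [centerEnd_add]; rfl
    rw [this, Ext.mk₀_add, Ext.comp_add]
    rfl
  zero_smul x := by
    change x.comp (Ext.mk₀ ((restrictBimodule k φ).map (centerEnd 0))) (add_zero p) = _
    have : (restrictBimodule k φ).map (centerEnd (0 : Subalgebra.center k B)) = 0 := by
      rw [centerEnd_zero]; rfl
    rw [this, Ext.mk₀_zero, Ext.comp_zero]

/-! ### The graded algebra `HH^*(A)` with the Yoneda product -/

theorem HHdeg_mk_comp {a b c d : ℕ} (x : HHdeg k A a) (y : HHdeg k A b) (h : a + b = c)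
    (h' : a + b = d) :
    GradedMonoid.mk (A := fun p => HHdeg k A p) c (Ext.comp x y h) =
      GradedMonoid.mk (A := fun p => HHdeg k A p) d (Ext.comp x y h') := by
  subst h
  subst h'
  rfl

/-- The unit of `HH^*(A)`. -/
instance : GradedMonoid.GOne (fun p => HHdeg k A p) := ⟨Ext.mk₀ (𝟙 _)⟩

/-- The product of `x` and `y` is the Yoneda composition `x ∘ y` (first `y`, then `x`). -/
instance : GradedMonoid.GMul (fun p => HHdeg k A p) :=
  ⟨fun {p q} x y => Ext.comp y x (add_comm q p)⟩

theorem HHdeg_mk_mul {p q : ℕ} (x : HHdeg k A p) (y : HHdeg k A q) :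
    GradedMonoid.mk (A := fun p => HHdeg k A p) p x * GradedMonoid.mk q y =
      GradedMonoid.mk (p + q) (Ext.comp y x (add_comm q p)) := rfl

theorem HHdeg_one :
    (1 : GradedMonoid fun p => HHdeg k A p) = GradedMonoid.mk 0 (Ext.mk₀ (𝟙 _)) := rfl

theorem HHdeg_one_mul (x : GradedMonoid fun p => HHdeg k A p) : 1 * x = x := by
  obtain ⟨p, x⟩ := x
  change 1 * GradedMonoid.mk p x = GradedMonoid.mk p x
  rw [HHdeg_one, HHdeg_mk_mul, HHdeg_mk_comp _ _ _ (add_zero p), Ext.comp_mk₀_id]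

theorem HHdeg_mul_one (x : GradedMonoid fun p => HHdeg k A p) : x * 1 = x := by
  obtain ⟨p, x⟩ := x
  change GradedMonoid.mk p x * 1 = GradedMonoid.mk p x
  rw [HHdeg_one, HHdeg_mk_mul, HHdeg_mk_comp _ _ _ (zero_add p), Ext.mk₀_id_comp]

theorem HHdeg_mul_assoc (x y z : GradedMonoid fun p => HHdeg k A p) :
    x * y * z = x * (y * z) := by
  obtain ⟨p, x⟩ := x
  obtain ⟨q, y⟩ := y
  obtain ⟨r, z⟩ := z
  change GradedMonoid.mk p x * GradedMonoid.mk q y * GradedMonoid.mk r z =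
    GradedMonoid.mk p x * (GradedMonoid.mk q y * GradedMonoid.mk r z)
  rw [HHdeg_mk_mul, HHdeg_mk_mul, HHdeg_mk_mul, HHdeg_mk_mul,
    ← Ext.comp_assoc z y x (add_comm r q) (add_comm q p) (by omega : r + q + p = p + q + r),
    HHdeg_mk_comp _ _ _ (by omega : q + r + p = p + (q + r))]

instance : DirectSum.GRing (fun p => HHdeg k A p) where
  mul_zero _ := by
    change Ext.comp 0 _ _ = _
    rw [Ext.zero_comp]
  zero_mul _ := Ext.comp_zero _ _ _ _ _
  mul_add _ _ _ := Ext.add_comp _ _ _ _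
  add_mul _ _ _ := Ext.comp_add _ _ _ _
  one_mul := HHdeg_one_mul
  mul_one := HHdeg_mul_one
  mul_assoc := HHdeg_mul_assoc
  natCast n := n • (Ext.mk₀ (𝟙 _) : HHdeg k A 0)
  natCast_zero := zero_smul _ _
  natCast_succ n := succ_nsmul _ _
  intCast n := n • (Ext.mk₀ (𝟙 _) : HHdeg k A 0)
  intCast_ofNat n := natCast_zsmul _ _
  intCast_negSucc_ofNat n := negSucc_zsmul _ _

instance : DirectSum.GAlgebra k (fun p => HHdeg k A p) where
  toFun :=
    { toFun := fun r => r • (Ext.mk₀ (𝟙 _) : HHdeg k A 0)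
      map_zero' := zero_smul _ _
      map_add' := fun r s => add_smul _ _ _ }
  map_one := one_smul _ _
  map_mul r s := by
    change GradedMonoid.mk 0 ((r * s) • (Ext.mk₀ (𝟙 _) : HHdeg k A 0)) =
      GradedMonoid.mk 0 (r • (Ext.mk₀ (𝟙 _) : HHdeg k A 0)) *
        GradedMonoid.mk 0 (s • (Ext.mk₀ (𝟙 _) : HHdeg k A 0))
    rw [HHdeg_mk_mul, HHdeg_mk_comp _ _ _ (add_zero 0), Ext.comp_smul, Ext.comp_mk₀_id, smul_smul]
  commutes r x := by
    obtain ⟨p, x⟩ := x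
    change GradedMonoid.mk 0 (r • (Ext.mk₀ (𝟙 _) : HHdeg k A 0)) * GradedMonoid.mk p x =
      GradedMonoid.mk p x * GradedMonoid.mk 0 (r • (Ext.mk₀ (𝟙 _) : HHdeg k A 0))
    rw [HHdeg_mk_mul, HHdeg_mk_mul, HHdeg_mk_comp _ _ _ (add_zero p),
      HHdeg_mk_comp _ _ (add_comm 0 p) (zero_add p), Ext.comp_smul, Ext.comp_mk₀_id,
      Ext.smul_comp, Ext.mk₀_id_comp]
  smul_def r x := by
    obtain ⟨p, x⟩ := x
    change GradedMonoid.mk p (r • x) =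
      GradedMonoid.mk 0 (r • (Ext.mk₀ (𝟙 _) : HHdeg k A 0)) * GradedMonoid.mk p x
    rw [HHdeg_mk_mul, HHdeg_mk_comp _ _ _ (add_zero p), Ext.comp_smul, Ext.comp_mk₀_id]

variable (k A) in
/-- The Hochschild cohomology algebra `HH^*(A) = ⨁ p, HH^p(A)`, with the Yoneda product. -/
def HH : Type u := ⨁ p, HHdeg k A p

instance : Ring (HH k A) := inferInstanceAs (Ring (⨁ p, HHdeg k A p))
instance : Algebra k (HH k A) := inferInstanceAs (Algebra k (⨁ p, HHdeg k A p))

/-- A homogeneous class of degree `p`, viewed in `HH^*(A)`. -/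
def HH.of (p : ℕ) : HHdeg k A p →+ HH k A := DirectSum.of (fun p => HHdeg k A p) p

/-- The homogeneous component of degree `p`. -/
def HH.component (p : ℕ) : HH k A →+ HHdeg k A p where
  toFun x := (show ⨁ p, HHdeg k A p from x) p
  map_zero' := rfl
  map_add' _ _ := rfl

theorem HH.of_mul_of {p q : ℕ} (x : HHdeg k A p) (y : HHdeg k A q) :
    HH.of p x * HH.of q y = HH.of (p + q) (Ext.comp y x (add_comm q p)) :=
  DirectSum.of_mul_of (A := fun p => HHdeg k A p) x y

open scoped Classical in
theorem HH.component_mul_eq_zero (x y : HH k A) (r : ℕ)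
    (h : ∀ p q, p + q = r → HH.component p x = 0 ∨ HH.component q y = 0) :
    HH.component r (x * y) = 0 := by
  change ((show ⨁ p, HHdeg k A p from x) * (show ⨁ p, HHdeg k A p from y)) r = 0
  rw [DirectSum.mul_eq_sum_support_ghas_mul, DFinsupp.finsetSum_apply]
  refine Finset.sum_eq_zero fun ij hij => ?_
  rw [Finset.mem_product, DFinsupp.mem_support_iff, DFinsupp.mem_support_iff] at hij
  refine DirectSum.of_eq_of_ne _ _ _ fun hr => ?_
  rcases h ij.1 ij.2 hr.symm with h | h
  · exact hij.1 h
  · exact hij.2 h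

variable (k A) in
/-- The even part `HH^ev(A)`. -/
def HHeven : Subalgebra k (HH k A) where
  carrier := {x | ∀ p, Odd p → HH.component p x = 0}
  add_mem' {x y} hx hy p hp := by rw [map_add, hx p hp, hy p hp, add_zero]
  mul_mem' {x y} hx hy r hr := by
    refine HH.component_mul_eq_zero x y r fun p q hpq => ?_
    rcases Nat.even_or_odd p with hp | hp
    · exact Or.inr (hy q (by subst hpq; exact (Nat.odd_add'.1 hr).2 hp))
    · exact Or.inl (hx p hp)
  algebraMap_mem' r p hp := by
    change (algebraMap k (⨁ p, HHdeg k A p) r) p = 0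
    rw [DirectSum.algebraMap_apply]
    exact DirectSum.of_eq_of_ne _ _ _ (by rintro rfl; simp at hp)

variable (k A) in
/-- The odd part `HH^odd(A)`, as a module over `HH^ev(A)`. -/
def HHodd : Submodule (HHeven k A) (HH k A) where
  carrier := {x | ∀ p, Even p → HH.component p x = 0}
  add_mem' {x y} hx hy p hp := by rw [map_add, hx p hp, hy p hp, add_zero]
  zero_mem' p _ := map_zero _
  smul_mem' c x hx r hr := by
    change HH.component r ((c : HH k A) * x) = 0
    refine HH.component_mul_eq_zero _ x r fun p q hpq => ?_
    rcases Nat.even_or_odd p with hp | hp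
    · exact Or.inr (hx q (by subst hpq; exact (Nat.even_add.1 hr).1 hp))
    · exact Or.inl (c.2 p hp)

/-- The action of `HH^ev(A)` on `HH^odd(A)` by multiplication from the left. -/
instance : Module (HHeven k A) (HHodd k A) := (HHodd k A).module

theorem HHodd_coe_smul (c : HHeven k A) (x : HHodd k A) :
    ((c • x : HHodd k A) : HH k A) = (c : HH k A) * (x : HH k A) := rfl

/-! ### The class of a singular extension -/

/-- The class `ζ ∈ H^2(A, M) = Ext_{A^e}^2(A, M)` is represented by the Hochschild `2`-cocycle `c`:
there is an exact sequence of bimodules `0 → M → E → P → A → 0` with Yoneda class `ζ` (spliced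
from `0 → K → P → A → 0` and `0 → M → E → K → 0`) and a lift of the identity of `A`
to a morphism to it from the standard resolution
`⋯ → A ⊗ A ⊗ A ⊗ A → A ⊗ A ⊗ A → A ⊗ A → A → 0`
whose component `A ⊗ A ⊗ A ⊗ A → M` is `1 ⊗ a ⊗ b ⊗ 1 ↦ c a b`. The components of lower degree
are given by `1 ⊗ 1 ↦ u` and `1 ⊗ a ⊗ 1 ↦ s a`. -/
def RepresentedByCocycle {M : ModuleCat.{u} (Enveloping k A)}
    (ζ : HochschildCohomology k M 2) (c : A → A → M) : Prop :=
  ∃ (K P E : ModuleCat.{u} (Enveloping k A))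
    (i : K ⟶ P) (ε : P ⟶ regularBimodule k A) (w₀ : i ≫ ε = 0)
    (h₀ : (ShortComplex.mk i ε w₀).ShortExact)
    (j : M ⟶ E) (p : E ⟶ K) (w₁ : j ≫ p = 0)
    (h₁ : (ShortComplex.mk j p w₁).ShortExact)
    (u : P) (s : A →+ E),
    ε.hom u = (show regularBimodule k A from (1 : A)) ∧
    (∀ (r : k) (a : A), s (r • a) = algebraMap k (Enveloping k A) r • s a) ∧
    (∀ a : A, i.hom (p.hom (s a)) =
      (a ⊗ₜ[k] 1 : Enveloping k A) • u - (1 ⊗ₜ[k] MulOpposite.op a : Enveloping k A) • u) ∧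
    (∀ a b : A, j.hom (c a b) = (a ⊗ₜ[k] 1 : Enveloping k A) • s b - s (a * b)
      + (1 ⊗ₜ[k] MulOpposite.op b : Enveloping k A) • s a) ∧
    ζ = Ext.comp h₀.extClass h₁.extClass rfl

/-- `ζ ∈ H^2(A, M)` is the class of the singular extension `0 → M → C → A → 0` with maps `θ : M → C`
and `π : C → A`: it is represented by the factor set `σ a σ b - σ (a b)` of a linear section `σ`. -/
def IsSingularExtensionClass {C : Type u} [Ring C] [Algebra k C] (π : C →ₐ[k] A)
    {M : ModuleCat.{u} (Enveloping k A)} (θ : M → C) (ζ : HochschildCohomology k M 2) : Prop :=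
  ∃ (σ : A →ₗ[k] C) (c : A → A → M),
    (∀ a, π (σ a) = a) ∧ (∀ a b, θ (c a b) = σ a * σ b - σ (a * b)) ∧ RepresentedByCocycle ζ c

end Hochschild

/-! ### The crown quiver and the truncated cycle algebras -/

/-- The vertex set `ℤ/n` of the `n`-crown quiver. -/
def Crown (n : ℕ) : Type := ZMod n

namespace Crown

instance (n : ℕ) : DecidableEq (Crown n) := inferInstanceAs (DecidableEq (ZMod n))
instance (n : ℕ) [NeZero n] : Fintype (Crown n) := inferInstanceAs (Fintype (ZMod n))

/-- The vertex following `i`. -/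
def next {n : ℕ} (i : Crown n) : Crown n := (show ZMod n from i) + 1

/-- There is exactly one arrow from `i` to `i + 1`, for each `i`, and no other arrow. -/
instance (n : ℕ) : Quiver (Crown n) := ⟨fun i j => PLift (j = i.next)⟩

/-- The arrow `α_i : i → i + 1`. -/
def arrow {n : ℕ} (i : Crown n) : i ⟶ i.next := ⟨rfl⟩

variable (k : Type u) [Field k] (n : ℕ) [NeZero n]

/-- The sum `t` of all arrows in the path algebra. -/
def t : PathAlgebra k (Crown n) :=
  ∑ i : Crown n, PathAlgebra.ofPath k ⟨i, i.next, (arrow i).toPath⟩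

/-- The two-sided ideal `I = (t^l)` of the path algebra. -/
def ideal (l : ℕ) : Ideal (PathAlgebra k (Crown n)) :=
  TwoSidedIdeal.asIdeal (TwoSidedIdeal.span {t k n ^ l})

instance (l : ℕ) : (ideal k n l).IsTwoSided := by unfold ideal; infer_instance

/-- The truncated cycle algebra `B = kQ/(t^l)`. -/
def Truncated (l : ℕ) : Type u := PathAlgebra k (Crown n) ⧸ ideal k n l

instance (l : ℕ) : Ring (Truncated k n l) :=
  inferInstanceAs (Ring (PathAlgebra k (Crown n) ⧸ ideal k n l))
instance (l : ℕ) : Algebra k (Truncated k n l) :=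
  inferInstanceAs (Algebra k (PathAlgebra k (Crown n) ⧸ ideal k n l))

/-- The projection `kQ → B`. -/
def proj (l : ℕ) : PathAlgebra k (Crown n) →ₐ[k] Truncated k n l :=
  Ideal.Quotient.mkₐ k (ideal k n l)

/-- The algebra `kQ/I^2`. -/
def SquareQuotient (l : ℕ) : Type u :=
  PathAlgebra k (Crown n) ⧸ (ideal k n l * ideal k n l)

instance (l : ℕ) : Ring (SquareQuotient k n l) :=
  inferInstanceAs (Ring (PathAlgebra k (Crown n) ⧸ (ideal k n l * ideal k n l)))
instance (l : ℕ) : Algebra k (SquareQuotient k n l) :=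
  inferInstanceAs (Algebra k (PathAlgebra k (Crown n) ⧸ (ideal k n l * ideal k n l)))

/-- The projection `kQ → kQ/I^2`. -/
def toSquareQuotient (l : ℕ) : PathAlgebra k (Crown n) →ₐ[k] SquareQuotient k n l :=
  Ideal.Quotient.mkₐ k (ideal k n l * ideal k n l)

/-- The projection `kQ/I^2 → B`. -/
def squareProj (l : ℕ) : SquareQuotient k n l →ₐ[k] Truncated k n l :=
  Ideal.Quotient.factorₐ k Ideal.mul_le_left

/-- The map `B ≅ I/I^2 ⊆ kQ/I^2` induced by right multiplication by `t^l`. -/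
def theta (l : ℕ) : Truncated k n l →+ SquareQuotient k n l :=
  QuotientAddGroup.lift _
    (((Ideal.Quotient.mk (ideal k n l * ideal k n l)).toAddMonoidHom).comp
      (AddMonoidHom.mulRight (t k n ^ l))) (by
    intro x hx
    refine Ideal.Quotient.eq_zero_iff_mem.2 (Ideal.mul_mem_mul hx ?_)
    exact TwoSidedIdeal.mem_asIdeal.2 (TwoSidedIdeal.subset_span rfl))

theorem theta_proj (l : ℕ) (a : PathAlgebra k (Crown n)) :
    theta k n l (proj k n l a) = toSquareQuotient k n l (a * t k n ^ l) := rfl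

theorem squareProj_toSquareQuotient (l : ℕ) (a : PathAlgebra k (Crown n)) :
    squareProj k n l (toSquareQuotient k n l a) = proj k n l a := rfl

/-- `H^1(kQ, B)`. -/
abbrev H1 (l : ℕ) : Type u :=
  HochschildCohomology k
    ((restrictBimodule k (proj k n l)).obj (regularBimodule k (Truncated k n l))) 1

end Crown

end

/-!
The truncated algebra `B = kQ/(t^l)` is treated through a *cyclic frame*: orthogonal idempotents
`e i` with sum `1`, indexed by `ℤ/n`, and an element `t` with `t e_i = e_{i+1} t`, such that the
elements `e_i t^b` span. The path algebra `kQ` has such a frame, and `B` inherits its image.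

In the enveloping algebra put `T = t ⊗ 1`, `U = 1 ⊗ t` and `E_j = ∑ i, e_{i+j} ⊗ e_i`. The left
ideals `P_j = A^e E_j` are projective bimodules, and everything reduces to the two elements `T - U`
and `N = ∑ a < l, T^a U^(l-1-a)`, with `(T - U) N = T^l - U^l`. Right multiplication by `T - U`
maps `P_1` to `P_0`, with cokernel the regular bimodule. For `kQ` this map is injective
(`CyclicFrame.shortExact_d_aug`); for `B` its kernel is the bimodule generated by `N E_1`, which is
a copy of `B` because `l` is divisible by `n` (`CyclicFrame.IsTruncated.shortExact_S₁`). Hence there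
is an exact sequence `0 → B → P_1 → P_0 → B → 0`, and its Yoneda class is `ζ`.

Since `P_0` and `P_1` are projective, multiplication by `ζ` is surjective in all degrees and
injective in positive ones. It is injective in degree zero as well: a bimodule map `P_1 → B` is
given by an element of `∑ i, e_{i+1} B e_i`, which is a multiple of `t` as `n ≥ 2`, and `N` kills
such multiples, so every map `P_1 → B` vanishes on the copy of `B`
(`CyclicFrame.IsTruncated.mulRightTwo_zeta_bijective`). A degree one class lifts to an explicit
chain endomorphism of degree one of the periodic resolution; it shows that the class commutes with
`ζ`, and that products of two classes of degree one vanish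
(`CyclicFrame.IsTruncated.exists_periodic_lift`). These facts determine the algebra
(`HH.periodic_structure`).

The remaining points are comparisons. The derivation `kQ → P_1` with `t ↦ E_1` gives the first
component of a chain map from the standard resolution, and its second component is the factor set
of `kQ/I^2` (`Crown.isSingularExtensionClass_zeta`). Finally `H^1(kQ, B)` and `HH^1(B)` are
quotients of `B` by the same subgroup (`Crown.exists_H1_equiv`), because no map `P_1 → B` sees the
relation `t^l = 0`.
-/

noncomputable section

/-! ### Ext groups and short exact sequences with projective middle term -/

section ProjectiveMiddle

variable {C : Type v} [Category.{w} C] [Abelian C] [HasExt.{u} C]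

namespace CategoryTheory.ShortComplex.ShortExact

/-- Dimension shifting: `Ext^n(X₁, M) → Ext^{n+1}(X₃, M)` is surjective if `X₂` is projective. -/
theorem extClass_comp_surjective {S : ShortComplex C} (hS : S.ShortExact) [Projective S.X₂]
    {M : C} {n n' : ℕ} (h : 1 + n = n') (x : Ext.{u} S.X₃ M n') :
    ∃ y : Ext.{u} S.X₁ M n, hS.extClass.comp y h = x := by
  obtain rfl : n' = n + 1 := by omega
  exact Ext.contravariant_sequence_exact₃ hS M x (Ext.eq_zero_of_projective _) h

/-- Dimension shifting: `Ext^n(X₁, M) → Ext^{n+1}(X₃, M)` is injective for `n > 0` if `X₂` is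
projective. -/
theorem extClass_comp_injective {S : ShortComplex C} (hS : S.ShortExact) [Projective S.X₂]
    {M : C} {n n' : ℕ} (h : 1 + (n + 1) = n') {y : Ext.{u} S.X₁ M (n + 1)}
    (hy : hS.extClass.comp y h = 0) : y = 0 := by
  obtain ⟨x, rfl⟩ := Ext.contravariant_sequence_exact₁ hS M y h hy
  rw [Ext.eq_zero_of_projective x, Ext.comp_zero]

theorem exists_extClass_comp_mk₀ {S : ShortComplex C} (hS : S.ShortExact) [Projective S.X₂]
    {M : C} (x : Ext.{u} S.X₃ M 1) :
    ∃ f : S.X₁ ⟶ M, hS.extClass.comp (Ext.mk₀ f) (add_zero 1) = x := by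
  obtain ⟨y, hy⟩ := hS.extClass_comp_surjective (add_zero 1) x
  obtain ⟨f, rfl⟩ := (Ext.mk₀_bijective _ _).2 y
  exact ⟨f, hy⟩

theorem extClass_comp_mk₀_eq_zero_iff {S : ShortComplex C} (hS : S.ShortExact) {M : C}
    (f : S.X₁ ⟶ M) :
    hS.extClass.comp (Ext.mk₀ f) (add_zero 1) = 0 ↔ ∃ g : S.X₂ ⟶ M, S.f ≫ g = f := by
  constructor
  · intro h
    obtain ⟨x, hx⟩ := Ext.contravariant_sequence_exact₁ hS M _ _ h
    obtain ⟨g, rfl⟩ := (Ext.mk₀_bijective _ _).2 x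
    rw [Ext.mk₀_comp_mk₀] at hx
    exact ⟨g, (Ext.mk₀_bijective _ _).1 hx⟩
  · rintro ⟨g, rfl⟩
    rw [← Ext.mk₀_comp_mk₀, hS.extClass_comp_assoc]

end CategoryTheory.ShortComplex.ShortExact

end ProjectiveMiddle

/-! ### Periodic Hochschild cohomology algebras -/

section Periodic

variable {k : Type u} [Field k] {A : Type u} [Ring A] [Algebra k A]

namespace HH

theorem component_of_same {p : ℕ} (x : HHdeg k A p) : component p (of p x) = x :=
  DirectSum.of_eq_same (β := fun p => HHdeg k A p) p x

theorem component_of_ne {p q : ℕ} (x : HHdeg k A p) (h : p ≠ q) : component q (of p x) = 0 :=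
  DirectSum.of_eq_of_ne (β := fun p => HHdeg k A p) p q x h.symm

theorem ext {x y : HH k A} (h : ∀ p, component p x = component p y) : x = y :=
  DFinsupp.ext (β := fun p => HHdeg k A p) h

theorem mem_of_forall_component_mem (H : AddSubgroup (HH k A)) (x : HH k A)
    (h : ∀ p, of p (component p x) ∈ H) : x ∈ H := by
  classical
  rw [← show (∑ p ∈ DFinsupp.support (β := fun p => HHdeg k A p) x, of p (component p x)) = x from
    DirectSum.sum_support_of (β := fun p => HHdeg k A p) x]
  exact H.sum_mem fun p _ => h p

theorem of_mem_even {p : ℕ} (hp : Even p) (x : HHdeg k A p) : of p x ∈ HHeven k A := fun q hq =>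
  component_of_ne x (by rintro rfl; exact Nat.not_odd_iff_even.2 hp hq)

theorem of_mem_odd {p : ℕ} (hp : Odd p) (x : HHdeg k A p) : of p x ∈ HHodd k A := fun q hq =>
  component_of_ne x (by rintro rfl; exact Nat.not_odd_iff_even.2 hq hp)

theorem eq_zero_of_mem_even_odd {x : HH k A} (h : x ∈ HHeven k A) (h' : x ∈ HHodd k A) : x = 0 :=
  ext fun p => by
    rw [map_zero]
    rcases Nat.even_or_odd p with hp | hp
    · exact h' p hp
    · exact h p hp

theorem exists_even_add_odd (x : HH k A) : ∃ a ∈ HHeven k A, ∃ b ∈ HHodd k A, a + b = x := by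
  refine mem_of_forall_component_mem
    ({ carrier := {x | ∃ a ∈ HHeven k A, ∃ b ∈ HHodd k A, a + b = x}
       add_mem' := ?_
       zero_mem' := ⟨0, zero_mem _, 0, zero_mem _, add_zero _⟩
       neg_mem' := ?_ } : AddSubgroup (HH k A)) x fun p => ?_
  · rintro _ _ ⟨a, ha, b, hb, rfl⟩ ⟨c, hc, d, hd, rfl⟩
    exact ⟨a + c, add_mem ha hc, b + d, add_mem hb hd, by abel⟩
  · rintro _ ⟨a, ha, b, hb, rfl⟩
    exact ⟨-a, neg_mem ha, -b, neg_mem hb, by abel⟩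
  · rcases Nat.even_or_odd p with hp | hp
    · exact ⟨_, of_mem_even hp _, 0, zero_mem _, add_zero _⟩
    · exact ⟨0, zero_mem _, _, of_mem_odd hp _, zero_add _⟩

/-- Right multiplication by `ζ ∈ HH^2(A)`. -/
def mulRightTwo (ζ : HHdeg k A 2) (p : ℕ) : HHdeg k A p →+ HHdeg k A (p + 2) where
  toFun x := Ext.comp ζ x (add_comm 2 p)
  map_zero' := Ext.comp_zero _ _ _ _ _
  map_add' _ _ := Ext.comp_add _ _ _ _

theorem of_mulRightTwo (ζ : HHdeg k A 2) (p : ℕ) (x : HHdeg k A p) :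
    of (p + 2) (mulRightTwo ζ p x) = of p x * of 2 ζ := (of_mul_of x ζ).symm

/-- Right multiplication by the power `ζ ^ i` of `ζ ∈ HH^2(A)`. -/
def mulRightTwoPow (ζ : HHdeg k A 2) (p : ℕ) : (i : ℕ) → HHdeg k A p →+ HHdeg k A (p + 2 * i)
  | 0 => AddMonoidHom.id _
  | i + 1 => (mulRightTwo ζ (p + 2 * i)).comp (mulRightTwoPow ζ p i)

theorem of_mulRightTwoPow (ζ : HHdeg k A 2) (p i : ℕ) (x : HHdeg k A p) :
    of (p + 2 * i) (mulRightTwoPow ζ p i x) = of p x * of 2 ζ ^ i := by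
  induction i with
  | zero => exact (mul_one _).symm
  | succ i ih => rw [pow_succ, ← mul_assoc, ← ih]; exact of_mulRightTwo _ _ _

theorem mulRightTwoPow_bijective {ζ : HHdeg k A 2}
    (hζ : ∀ p, Function.Bijective (mulRightTwo ζ p)) (p i : ℕ) :
    Function.Bijective (mulRightTwoPow ζ p i) := by
  induction i with
  | zero => exact Function.bijective_id
  | succ i ih => exact (hζ _).comp ih

/-- The map `⨁ i, H ζ ^ i → HH^*(A)` given by a map `ψ : H → HH^q(A)`. -/
def powerSum {H : Type u} [AddCommGroup H] (ζ : HHdeg k A 2) (q : ℕ) (ψ : H →+ HHdeg k A q) :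
    (ℕ →₀ H) →+ HH k A :=
  Finsupp.liftAddHom fun i => (of (q + 2 * i)).comp ((mulRightTwoPow ζ q i).comp ψ)

section

variable {H : Type u} [AddCommGroup H] (ζ : HHdeg k A 2) (q : ℕ) (ψ : H →+ HHdeg k A q)

theorem powerSum_single (i : ℕ) (h : H) :
    powerSum ζ q ψ (Finsupp.single i h) = of (q + 2 * i) (mulRightTwoPow ζ q i (ψ h)) :=
  Finsupp.liftAddHom_apply_single _ _ _

theorem powerSum_single' (i : ℕ) (h : H) :
    powerSum ζ q ψ (Finsupp.single i h) = of q (ψ h) * of 2 ζ ^ i := by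
  rw [powerSum_single, of_mulRightTwoPow]

theorem component_powerSum (v : ℕ →₀ H) (i : ℕ) :
    component (q + 2 * i) (powerSum ζ q ψ v) = mulRightTwoPow ζ q i (ψ (v i)) := by
  induction v using Finsupp.induction_linear with
  | zero => simp
  | add v w hv hw => simp only [map_add, hv, hw, Finsupp.add_apply]
  | single j h =>
    rw [powerSum_single]
    by_cases hj : j = i
    · subst hj
      rw [component_of_same, Finsupp.single_eq_same]
    · rw [component_of_ne _ (by omega), Finsupp.single_eq_of_ne (Ne.symm hj), map_zero, map_zero]

theorem component_powerSum_eq_zero (v : ℕ →₀ H) {p : ℕ} (hp : ∀ i, q + 2 * i ≠ p) :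
    component p (powerSum ζ q ψ v) = 0 := by
  induction v using Finsupp.induction_linear with
  | zero => simp
  | add v w hv hw => rw [map_add, map_add, hv, hw, add_zero]
  | single j h => rw [powerSum_single, component_of_ne _ (hp j)]

variable {ζ q ψ}

theorem powerSum_injective (hζ : ∀ p, Function.Bijective (mulRightTwo ζ p))
    (hψ : Function.Injective ψ) : Function.Injective (powerSum ζ q ψ) := fun v w h =>
  Finsupp.ext fun i => hψ ((mulRightTwoPow_bijective hζ q i).1 (by
    rw [← component_powerSum, ← component_powerSum, h]))

theorem exists_powerSum_eq (hζ : ∀ p, Function.Bijective (mulRightTwo ζ p))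
    (hψ : Function.Surjective ψ) (x : HH k A)
    (hx : ∀ p, (∀ i, q + 2 * i ≠ p) → component p x = 0) : ∃ v, powerSum ζ q ψ v = x := by
  refine mem_of_forall_component_mem (powerSum ζ q ψ).range x fun p => ?_
  by_cases hp : ∃ i, q + 2 * i = p
  · obtain ⟨i, rfl⟩ := hp
    obtain ⟨y, hy⟩ := (mulRightTwoPow_bijective hζ q i).2 (component (q + 2 * i) x)
    obtain ⟨h, rfl⟩ := hψ y
    exact ⟨Finsupp.single i h, by rw [powerSum_single, hy]⟩
  · rw [hx p (not_exists.1 hp), map_zero]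
    exact zero_mem _

end

theorem centerClass_zero : centerClass (0 : Subalgebra.center k A) = 0 := by
  rw [centerClass, centerEnd_zero, Ext.mk₀_zero]

theorem centerClass_add (y z : Subalgebra.center k A) :
    centerClass (y + z) = centerClass y + centerClass z := by
  rw [centerClass, centerEnd_add, Ext.mk₀_add]; rfl

theorem of_centerClass_one : of 0 (centerClass (1 : Subalgebra.center k A)) = 1 := by
  rw [centerClass, centerEnd_one]; rfl

theorem of_centerClass_mul (y z : Subalgebra.center k A) :
    of 0 (centerClass (y * z)) = of 0 (centerClass y) * of 0 (centerClass z) := by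
  rw [of_mul_of, centerClass, centerEnd_mul, ← Ext.mk₀_comp_mk₀]; rfl

theorem of_centerClass_algebraMap (r : k) :
    of 0 (centerClass (algebraMap k (Subalgebra.center k A) r)) = algebraMap k (HH k A) r := by
  have h : centerClass (algebraMap k (Subalgebra.center k A) r) =
      r • (Ext.mk₀ (𝟙 _) : HHdeg k A 0) := by
    rw [centerClass, ← Ext.mk₀_smul]
    congr 1
    refine ModuleCat.hom_ext (LinearMap.ext fun x => ?_)
    change (algebraMap k A r) * (show A from x) = algebraMap k (Enveloping k A) r • x
    rw [Algebra.TensorProduct.algebraMap_apply]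
    exact ((regularBimodule_tmul_smul (k := k) (algebraMap k A r) 1 x).trans (mul_one _)).symm
  rw [h]
  exact (DirectSum.algebraMap_apply k (fun p => HHdeg k A p) r).symm

/-- The embedding of the centre into the even part `HH^ev(A)`, as degree `0`. -/
def centerToEven : Subalgebra.center k A →ₐ[k] HHeven k A where
  toFun z := ⟨of 0 (centerClass z), of_mem_even Even.zero _⟩
  map_one' := Subtype.ext of_centerClass_one
  map_mul' y z := Subtype.ext (of_centerClass_mul y z)
  map_zero' := Subtype.ext ((congrArg _ centerClass_zero).trans (map_zero _))
  map_add' y z := Subtype.ext ((congrArg _ (centerClass_add y z)).trans (map_add _ _ _))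
  commutes' r := Subtype.ext (of_centerClass_algebraMap r)

variable (k A) in
/-- The embedding of the centre as the degree `0` classes. -/
def centerHom : Subalgebra.center k A →+ HHdeg k A 0 where
  toFun := centerClass
  map_zero' := centerClass_zero
  map_add' := centerClass_add

/-- The morphism `Z(A)[X] → HH^ev(A)` with `X ↦ ζ`, for `ζ ∈ HH^2(A)` commuting with `Z(A)`. -/
def evenMap (ζ : HHdeg k A 2)
    (hcζ : ∀ z : Subalgebra.center k A, Commute (of 0 (centerClass z)) (of 2 ζ)) :
    (Subalgebra.center k A)[X] →ₐ[k] HHeven k A :=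
  eval₂AlgHom centerToEven ⟨of 2 ζ, of_mem_even even_two ζ⟩ fun z => Subtype.ext (hcζ z)

section

variable {ζ : HHdeg k A 2}
  (hcζ : ∀ z : Subalgebra.center k A, Commute (of 0 (centerClass z)) (of 2 ζ))

theorem evenMap_X : (evenMap ζ hcζ X : HH k A) = of 2 ζ := congrArg Subtype.val (eval₂_X _ _)

theorem evenMap_C (z : Subalgebra.center k A) :
    (evenMap ζ hcζ (C z) : HH k A) = of 0 (centerClass z) := congrArg Subtype.val (eval₂_C _ _)

theorem evenMap_monomial (i : ℕ) (z : Subalgebra.center k A) :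
    (evenMap ζ hcζ (monomial i z) : HH k A) = of 0 (centerClass z) * of 2 ζ ^ i := by
  rw [← C_mul_X_pow_eq_monomial, map_mul, map_pow, Subalgebra.coe_mul, Subalgebra.coe_pow,
    evenMap_X, evenMap_C]

theorem evenMap_eq_powerSum (p : (Subalgebra.center k A)[X]) :
    (evenMap ζ hcζ p : HH k A) = powerSum ζ 0 (centerHom k A) p.toFinsupp.coeff := by
  induction p using Polynomial.induction_on' with
  | add p q hp hq => rw [map_add, Subalgebra.coe_add, hp, hq, ← map_add]; rfl
  | monomial i z =>
    rw [evenMap_monomial]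
    exact (powerSum_single' ζ 0 (centerHom k A) i z).symm

theorem evenMap_bijective (hζ : ∀ p, Function.Bijective (mulRightTwo ζ p))
    (hcenter : Function.Bijective (centerClass (k := k) (A := A))) :
    Function.Bijective (evenMap ζ hcζ) := by
  constructor
  · intro p q h
    have h' := powerSum_injective (ψ := centerHom k A) hζ hcenter.1
      (((evenMap_eq_powerSum hcζ p).symm.trans (congrArg Subtype.val h)).trans
        (evenMap_eq_powerSum hcζ q))
    ext i : 1
    exact DFunLike.congr_fun h' i
  · intro x
    obtain ⟨v, hv⟩ := exists_powerSum_eq (q := 0) (ψ := centerHom k A) hζ hcenter.2 (x : HH k A)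
      fun p hp => x.2 p (by
        by_contra h
        obtain ⟨i, hi⟩ := Nat.not_odd_iff_even.1 h
        exact hp i (by omega))
    exact ⟨⟨.ofCoeff v⟩, Subtype.ext ((evenMap_eq_powerSum hcζ _).trans hv)⟩

end

section

variable {H : Type u} [AddCommGroup H] [Module (Subalgebra.center k A) H]

/-- The map `H[ζ] → HH^odd(A)` given by a map `ψ : H → HH^1(A)`. -/
def oddMap (ζ : HHdeg k A 2) (ψ : H →+ HHdeg k A 1) :
    PolynomialModule (Subalgebra.center k A) H →+ HHodd k A where
  toFun v := ⟨powerSum ζ 1 ψ v.coeff, fun p hp =>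
    component_powerSum_eq_zero _ _ _ _ fun i hi => by
      subst hi; exact Nat.not_even_iff_odd.2 ⟨i, add_comm _ _⟩ hp⟩
  map_zero' := Subtype.ext (map_zero _)
  map_add' _ _ := Subtype.ext (map_add _ _ _)

theorem oddMap_single (ζ : HHdeg k A 2) (ψ : H →+ HHdeg k A 1) (i : ℕ) (h : H) :
    (oddMap ζ ψ (PolynomialModule.single _ i h) : HH k A) = of 1 (ψ h) * of 2 ζ ^ i :=
  powerSum_single' _ _ _ i h

theorem oddMap_bijective {ζ : HHdeg k A 2} {ψ : H →+ HHdeg k A 1}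
    (hζ : ∀ p, Function.Bijective (mulRightTwo ζ p)) (hψ : Function.Bijective ψ) :
    Function.Bijective (oddMap ζ ψ) := by
  constructor
  · intro v w h
    exact PolynomialModule.coeff_injective (powerSum_injective hζ hψ.1 (congrArg Subtype.val h))
  · intro x
    obtain ⟨v, hv⟩ := exists_powerSum_eq (q := 1) (ψ := ψ) hζ hψ.2 (x : HH k A) fun p hp =>
      x.2 p (by
        by_contra h
        obtain ⟨i, hi⟩ := Nat.not_even_iff_odd.1 h
        exact hp i (by omega))
    exact ⟨PolynomialModule.ofCoeff _ v, Subtype.ext hv⟩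

variable {ζ : HHdeg k A 2} {ψ : H →+ HHdeg k A 1}
  (hcζ : ∀ z : Subalgebra.center k A, Commute (of 0 (centerClass z)) (of 2 ζ))

theorem oddMap_smul (hxζ : ∀ x : HHdeg k A 1, Commute (of 1 x) (of 2 ζ))
    (hψ : ∀ (z : Subalgebra.center k A) (h : H),
      of 1 (ψ (z • h)) = of 0 (centerClass z) * of 1 (ψ h))
    (p : (Subalgebra.center k A)[X]) (v : PolynomialModule (Subalgebra.center k A) H) :
    oddMap ζ ψ (p • v) = evenMap ζ hcζ p • oddMap ζ ψ v := by
  refine Subtype.ext ?_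
  rw [HHodd_coe_smul]
  induction v using PolynomialModule.induction_linear with
  | zero => rw [smul_zero, map_zero]; exact (mul_zero _).symm
  | add v w hv hw =>
    rw [smul_add, map_add, map_add, Submodule.coe_add, Submodule.coe_add, hv, hw, mul_add]
  | single j h =>
    induction p using Polynomial.induction_on' with
    | add p q hp hq =>
      rw [add_smul, map_add, map_add, Submodule.coe_add, Subalgebra.coe_add, hp, hq, add_mul]
    | monomial i z =>
      rw [PolynomialModule.monomial_smul_single, oddMap_single, oddMap_single, hψ,
        evenMap_monomial, pow_add, mul_assoc, mul_assoc, ← mul_assoc (of 1 _),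
        ← mul_assoc (of 2 ζ ^ i), ((hxζ (ψ h)).pow_right i).eq]

theorem oddMap_mul_evenMap (hxζ : ∀ x : HHdeg k A 1, Commute (of 1 x) (of 2 ζ))
    (hcx : ∀ (z : Subalgebra.center k A) (x : HHdeg k A 1),
      Commute (of 0 (centerClass z)) (of 1 x))
    (p : (Subalgebra.center k A)[X]) (v : PolynomialModule (Subalgebra.center k A) H) :
    (oddMap ζ ψ v : HH k A) * evenMap ζ hcζ p = evenMap ζ hcζ p * oddMap ζ ψ v := by
  induction v using PolynomialModule.induction_linear with
  | zero => rw [map_zero]; exact (zero_mul _).trans (mul_zero _).symm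
  | add v w hv hw => rw [map_add, Submodule.coe_add, mul_add, add_mul, hv, hw]
  | single j h =>
    induction p using Polynomial.induction_on' with
    | add p q hp hq => rw [map_add, Subalgebra.coe_add, mul_add, add_mul, hp, hq]
    | monomial i z =>
      rw [oddMap_single, evenMap_monomial]
      exact (((hcx z _).mul_right ((hcζ z).pow_right j)).mul_left
        (((hxζ _).symm.pow_left i).mul_right ((Commute.refl _).pow_pow i j))).symm.eq

theorem oddMap_mul_oddMap (hxζ : ∀ x : HHdeg k A 1, Commute (of 1 x) (of 2 ζ))
    (hxx : ∀ x y : HHdeg k A 1, of 1 x * of 1 y = 0)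
    (v w : PolynomialModule (Subalgebra.center k A) H) :
    (oddMap ζ ψ v : HH k A) * (oddMap ζ ψ w : HH k A) = 0 := by
  induction v using PolynomialModule.induction_linear with
  | zero => rw [map_zero]; exact zero_mul _
  | add v v' hv hv' => rw [map_add, Submodule.coe_add, add_mul, hv, hv', add_zero]
  | single i h =>
    induction w using PolynomialModule.induction_linear with
    | zero => rw [map_zero]; exact mul_zero _
    | add w w' hw hw' => rw [map_add, Submodule.coe_add, mul_add, hw, hw', add_zero]
    | single j h' =>
      rw [oddMap_single, oddMap_single, mul_assoc, ← mul_assoc (of 2 ζ ^ i),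
        ← ((hxζ (ψ h')).pow_right i).eq, mul_assoc, ← mul_assoc, hxx, zero_mul]

end

/-- If `f` and `g` are bijections onto the even and the odd part, then so is their sum onto
`HH^*(A)`. -/
theorem bijective_even_add_odd {M N : Type u} {f : M → HHeven k A} {g : N → HHodd k A}
    (hf : Function.Bijective f) (hg : Function.Bijective g) :
    Function.Bijective fun q : M × N => (f q.1 : HH k A) + g q.2 := by
  constructor
  · rintro ⟨p, v⟩ ⟨q, w⟩ h
    change (f p : HH k A) + g v = (f q : HH k A) + g w at h
    have h1 : (f p : HH k A) - f q = g w - g v := by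
      rw [sub_eq_sub_iff_add_eq_add, h, add_comm]
    have h2 : (f p : HH k A) - f q = 0 := eq_zero_of_mem_even_odd (sub_mem (f p).2 (f q).2) (by
      rw [h1]
      exact sub_mem (g w).2 (g v).2)
    exact Prod.ext (hf.1 (Subtype.ext (sub_eq_zero.1 h2)))
      (hg.1 (Subtype.ext (sub_eq_zero.1 (h1.symm.trans h2)).symm))
  · intro x
    obtain ⟨a, ha, b, hb, rfl⟩ := exists_even_add_odd x
    obtain ⟨p, hp⟩ := hf.2 ⟨a, ha⟩
    obtain ⟨v, hv⟩ := hg.2 ⟨b, hb⟩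
    exact ⟨(p, v), by simp only [hp, hv]⟩

/-- If `ζ ∈ HH^2(A)` is central and multiplication by `ζ` is bijective in all degrees, while
`HH^0(A)` is the centre `Z(A)`, and degree one classes multiply to zero, then `HH^*(A)` is the
trivial extension of `Z(A)[ζ]` by `HH^1(A)[ζ]`. The module `HH^1(A)` enters through an isomorphic
copy `H`. -/
theorem periodic_structure {H : Type u} [AddCommGroup H] [Module (Subalgebra.center k A) H]
    (ζ : HHdeg k A 2) (hζ : ∀ p, Function.Bijective (mulRightTwo ζ p))
    (hcenter : Function.Bijective (centerClass (k := k) (A := A)))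
    (hcζ : ∀ z : Subalgebra.center k A, Commute (of 0 (centerClass z)) (of 2 ζ))
    (hxζ : ∀ x : HHdeg k A 1, Commute (of 1 x) (of 2 ζ))
    (hcx : ∀ (z : Subalgebra.center k A) (x : HHdeg k A 1),
      Commute (of 0 (centerClass z)) (of 1 x))
    (hxx : ∀ x y : HHdeg k A 1, of 1 x * of 1 y = 0)
    (ψ : H ≃+ HHdeg k A 1)
    (hψ : ∀ (z : Subalgebra.center k A) (h : H),
      of 1 (ψ (z • h)) = of 0 (centerClass z) * of 1 (ψ h)) :
    ∃ (Φ : (Subalgebra.center k A)[X] ≃ₐ[k] HHeven k A)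
      (Ψ : PolynomialModule (Subalgebra.center k A) H ≃+ HHodd k A),
      (Φ X : HH k A) = of 2 ζ ∧
      (∀ z, (Φ (C z) : HH k A) = of 0 (centerClass z)) ∧
      (∀ p v, Ψ (p • v) = Φ p • Ψ v) ∧
      (∀ h, ∃ x, (Ψ (PolynomialModule.single _ 0 h) : HH k A) = of 1 x) ∧
      (∀ x ∈ HHodd k A, ∀ y ∈ HHodd k A, x * y = 0) ∧
      ∃ Θ : HH k A ≃+ (Subalgebra.center k A)[X] × PolynomialModule (Subalgebra.center k A) H,
        (∀ p v, Θ ((Φ p : HH k A) + Ψ v) = (p, v)) ∧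
        ∀ x y, Θ (x * y) =
          ((Θ x).1 * (Θ y).1, (Θ x).1 • (Θ y).2 + (Θ y).1 • (Θ x).2) := by
  obtain ⟨Φ, hΦ⟩ : ∃ Φ : (Subalgebra.center k A)[X] ≃ₐ[k] HHeven k A,
      ∀ p, Φ p = evenMap ζ hcζ p :=
    ⟨AlgEquiv.ofBijective _ (evenMap_bijective hcζ hζ hcenter), fun _ => rfl⟩
  obtain ⟨Ψ, hΨ⟩ : ∃ Ψ : PolynomialModule (Subalgebra.center k A) H ≃+ HHodd k A,
      ∀ v, Ψ v = oddMap ζ (ψ : H →+ HHdeg k A 1) v :=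
    ⟨AddEquiv.ofBijective _ (oddMap_bijective hζ ψ.bijective), fun _ => rfl⟩
  have hmod : ∀ p v, Ψ (p • v) = Φ p • Ψ v := fun p v => by
    rw [hΨ, hΨ, hΦ, oddMap_smul hcζ hxζ hψ]
  have hcomm : ∀ p v, (Ψ v : HH k A) * Φ p = Φ p * Ψ v := fun p v => by
    rw [hΨ, hΦ, oddMap_mul_evenMap hcζ hxζ hcx]
  have hodd : ∀ v w, (Ψ v : HH k A) * Ψ w = 0 := fun v w => by
    rw [hΨ, hΨ, oddMap_mul_oddMap hxζ hxx]
  obtain ⟨S, hS⟩ : ∃ S : (Subalgebra.center k A)[X] × PolynomialModule (Subalgebra.center k A) H ≃+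
      HH k A, ∀ q, S q = (Φ q.1 : HH k A) + Ψ q.2 :=
    ⟨AddEquiv.mk' (Equiv.ofBijective _ (bijective_even_add_odd Φ.bijective Ψ.bijective))
      fun p q => by
        change (Φ (p.1 + q.1) : HH k A) + Ψ (p.2 + q.2) =
          ((Φ p.1 : HH k A) + Ψ p.2) + ((Φ q.1 : HH k A) + Ψ q.2)
        rw [map_add, map_add, Subalgebra.coe_add, Submodule.coe_add, add_add_add_comm],
      fun _ => rfl⟩
  refine ⟨Φ, Ψ, ?_, fun z => ?_, hmod, fun h => ⟨ψ h, ?_⟩, fun x hx y hy => ?_, S.symm,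
    fun p v => ?_, fun x y => ?_⟩
  · rw [hΦ, evenMap_X]
  · rw [hΦ, evenMap_C]
  · rw [hΨ, oddMap_single, pow_zero, mul_one]; rfl
  · obtain ⟨v, hv⟩ := Ψ.surjective ⟨x, hx⟩
    obtain ⟨w, hw⟩ := Ψ.surjective ⟨y, hy⟩
    have := hodd v w
    rwa [hv, hw] at this
  · rw [AddEquiv.symm_apply_eq, hS]
  · obtain ⟨⟨p, v⟩, rfl⟩ := S.surjective x
    obtain ⟨⟨q, w⟩, rfl⟩ := S.surjective y
    rw [AddEquiv.symm_apply_apply, AddEquiv.symm_apply_apply, AddEquiv.symm_apply_eq, hS, hS, hS,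
      map_mul, map_add, hmod, hmod, Submodule.coe_add, HHodd_coe_smul, HHodd_coe_smul,
      Subalgebra.coe_mul, add_mul, mul_add, mul_add, hcomm, hodd, add_zero, add_assoc]

end HH

end Periodic

/-! ### Cyclic frames and the enveloping algebra -/

/-- A complete set of orthogonal idempotents `e i` of `A`, indexed by `ℤ/n`, with an element `t`
that permutes them cyclically, such that the elements `e i * t ^ b` span `A`. -/
structure CyclicFrame (k : Type u) [Field k] (n : ℕ) [NeZero n] (A : Type u) [Ring A]
    [Algebra k A] where
  /-- The idempotents. -/
  e : ZMod n → A
  /-- The element permuting the idempotents. -/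
  t : A
  e_mul_e : ∀ i j, e i * e j = if i = j then e i else 0
  sum_e : ∑ i, e i = 1
  t_mul_e : ∀ i, t * e i = e (i + 1) * t
  mem_span : ∀ a, a ∈ Submodule.span k (Set.range fun p : ZMod n × ℕ => e p.1 * t ^ p.2)

namespace CyclicFrame

variable {k : Type u} [Field k] {n : ℕ} [NeZero n] {A : Type u} [Ring A] [Algebra k A]

variable (k) in
/-- The left multiplication `a ⊗ 1` in the enveloping algebra. -/
def left (a : A) : Enveloping k A := a ⊗ₜ[k] 1

variable (k) in
/-- The right multiplication `1 ⊗ a` in the enveloping algebra. -/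
def right (a : A) : Enveloping k A := 1 ⊗ₜ[k] MulOpposite.op a

theorem left_zero : left k (0 : A) = 0 := TensorProduct.zero_tmul _ _

theorem left_add (a b : A) : left k (a + b) = left k a + left k b := TensorProduct.add_tmul _ _ _

theorem left_mul (a b : A) : left k (a * b) = left k a * left k b := by
  simp [left, Algebra.TensorProduct.tmul_mul_tmul]

theorem left_pow (a : A) (b : ℕ) : left k (a ^ b) = left k a ^ b := by
  simp [left, Algebra.TensorProduct.tmul_pow]

theorem right_mul (a b : A) : right k (a * b) = right k b * right k a := by
  simp [right, Algebra.TensorProduct.tmul_mul_tmul]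

theorem right_pow (a : A) (b : ℕ) : right k (a ^ b) = right k a ^ b := by
  simp [right, Algebra.TensorProduct.tmul_pow]

theorem left_mul_right (a b : A) : left k a * right k b = a ⊗ₜ[k] MulOpposite.op b := by
  simp [left, right, Algebra.TensorProduct.tmul_mul_tmul]

theorem right_mul_left (a b : A) : right k b * left k a = a ⊗ₜ[k] MulOpposite.op b := by
  simp [left, right, Algebra.TensorProduct.tmul_mul_tmul]

theorem commute_left_right (a b : A) : Commute (left k a) (right k b) :=
  (left_mul_right (k := k) a b).trans (right_mul_left a b).symm

theorem right_smul (r : k) (a : A) :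
    right k (r • a) = left k (algebraMap k A r) * right k a := by
  rw [left_mul_right, Algebra.algebraMap_eq_smul_one, TensorProduct.smul_tmul]
  rfl

theorem right_zero : right k (0 : A) = 0 := TensorProduct.tmul_zero _ _

theorem right_add (a b : A) : right k (a + b) = right k a + right k b :=
  TensorProduct.tmul_add _ _ _

theorem enveloping_induction {P : Enveloping k A → Prop} (x : Enveloping k A)
    (hadd : ∀ x y, P x → P y → P (x + y)) (hmul : ∀ a b, P (left k a * right k b)) : P x := by
  induction x using TensorProduct.induction_on with
  | zero =>
    have h : (0 : A) ⊗ₜ[k] MulOpposite.op (0 : A) = 0 := TensorProduct.zero_tmul _ _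
    exact h ▸ left_mul_right (k := k) (0 : A) 0 ▸ hmul 0 0
  | add x y hx hy => exact hadd x y hx hy
  | tmul a b => exact left_mul_right (k := k) a b.unop ▸ hmul a b.unop

variable (F : CyclicFrame k n A)

theorem e_mul_self (i : ZMod n) : F.e i * F.e i = F.e i := by rw [F.e_mul_e, if_pos rfl]

theorem e_mul_t (i : ZMod n) : F.e (i + 1) * F.t = F.t * F.e i := (F.t_mul_e i).symm

theorem t_pow_mul_e (b : ℕ) (i : ZMod n) : F.t ^ b * F.e i = F.e (i + b) * F.t ^ b := by
  induction b generalizing i with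
  | zero => simp
  | succ b ih =>
    rw [pow_succ, mul_assoc, F.t_mul_e, ← mul_assoc, ih, mul_assoc, Nat.cast_succ,
      add_assoc, add_comm (1 : ZMod n)]

/-- The idempotent of `A ⊗ A^op` that cuts out `⨁ i, e (i + j) M e i` from a bimodule `M`. -/
def E (j : ZMod n) : Enveloping k A := ∑ i, left k (F.e (i + j)) * right k (F.e i)

/-- Left multiplication by `t`. -/
abbrev T : Enveloping k A := left k F.t

/-- Right multiplication by `t`. -/
abbrev U : Enveloping k A := right k F.t

theorem commute_T_U : Commute F.T F.U := commute_left_right _ _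

theorem right_e_mul_E (i j : ZMod n) :
    right k (F.e i) * F.E j = left k (F.e (i + j)) * right k (F.e i) := by
  rw [E, Finset.mul_sum, Finset.sum_eq_single i]
  · rw [← mul_assoc, ← (commute_left_right _ _).eq, mul_assoc, ← right_mul, F.e_mul_self]
  · intro i' _ hi'
    rw [← mul_assoc, ← (commute_left_right _ _).eq, mul_assoc, ← right_mul, F.e_mul_e, if_neg hi']
    exact (congrArg _ (TensorProduct.tmul_zero _ _)).trans (mul_zero _)
  · simp

theorem left_e_mul_E (i j : ZMod n) :
    left k (F.e (i + j)) * F.E j = left k (F.e (i + j)) * right k (F.e i) := by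
  rw [E, Finset.mul_sum, Finset.sum_eq_single i]
  · rw [← mul_assoc, ← left_mul, F.e_mul_self]
  · intro i' _ hi'
    rw [← mul_assoc, ← left_mul, F.e_mul_e, if_neg (fun h => hi' (add_right_cancel h).symm),
      left_zero, zero_mul]
  · simp

theorem E_mul_self (j : ZMod n) : F.E j * F.E j = F.E j := by
  conv_lhs => enter [1]; rw [E]
  rw [Finset.sum_mul, E]
  refine Finset.sum_congr rfl fun i _ => ?_
  rw [mul_assoc, ← E, F.right_e_mul_E, ← mul_assoc, ← left_mul, F.e_mul_self]

theorem T_mul_E (j : ZMod n) : F.T * F.E j = F.E (j + 1) * F.T := by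
  rw [E, E, Finset.mul_sum, Finset.sum_mul]
  refine Finset.sum_congr rfl fun i _ => ?_
  rw [← mul_assoc, ← left_mul, F.t_mul_e, left_mul, mul_assoc, mul_assoc,
    (commute_left_right _ _).eq, add_assoc]

theorem U_mul_E (j : ZMod n) : F.U * F.E j = F.E (j + 1) * F.U := by
  rw [E, E, Finset.mul_sum, Finset.sum_mul, ← Equiv.sum_comp (Equiv.addRight (1 : ZMod n))]
  refine Finset.sum_congr rfl fun i _ => ?_
  rw [Equiv.coe_addRight, ← mul_assoc, ← (commute_left_right _ _).eq, mul_assoc, mul_assoc,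
    ← right_mul, ← right_mul, F.t_mul_e, add_right_comm, add_assoc]

theorem T_pow_mul_E (b : ℕ) (j : ZMod n) : F.T ^ b * F.E j = F.E (j + b) * F.T ^ b := by
  induction b generalizing j with
  | zero => simp
  | succ b ih =>
    rw [pow_succ, mul_assoc, F.T_mul_E, ← mul_assoc, ih, mul_assoc, Nat.cast_succ, add_assoc,
      add_comm (1 : ZMod n)]

theorem U_pow_mul_E (b : ℕ) (j : ZMod n) : F.U ^ b * F.E j = F.E (j + b) * F.U ^ b := by
  induction b generalizing j with
  | zero => simp
  | succ b ih =>
    rw [pow_succ, mul_assoc, F.U_mul_E, ← mul_assoc, ih, mul_assoc, Nat.cast_succ, add_assoc,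
      add_comm (1 : ZMod n)]

/-- The norm element `∑ a < b, t ^ a ⊗ t ^ (b - 1 - a)`. -/
def N (b : ℕ) : Enveloping k A := ∑ a ∈ Finset.range b, F.T ^ a * F.U ^ (b - 1 - a)

theorem N_mul_sub (b : ℕ) : F.N b * (F.T - F.U) = F.T ^ b - F.U ^ b :=
  F.commute_T_U.geom_sum₂_mul b

theorem sub_mul_N (b : ℕ) : (F.T - F.U) * F.N b = F.T ^ b - F.U ^ b :=
  F.commute_T_U.mul_geom_sum₂ b

theorem N_mul_E (b : ℕ) : F.N b * F.E 1 = F.E b * F.N b := by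
  rw [N, Finset.sum_mul, Finset.mul_sum]
  refine Finset.sum_congr rfl fun a ha => ?_
  have h : 1 + ((b - 1 - a : ℕ) : ZMod n) + (a : ZMod n) = b := by
    have := Finset.mem_range.1 ha
    rw [← Nat.cast_one, ← Nat.cast_add, ← Nat.cast_add]
    congr 1
    omega
  rw [mul_assoc, F.U_pow_mul_E, ← mul_assoc, F.T_pow_mul_E, h, mul_assoc]

theorem sub_mul_E (j : ZMod n) : (F.T - F.U) * F.E j = F.E (j + 1) * (F.T - F.U) := by
  rw [sub_mul, mul_sub, F.T_mul_E, F.U_mul_E]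

/-! ### Normal forms in the bimodules generated by the idempotents -/

/-- The element `∑ b, (a b ⊗ t ^ b) E j` of the left ideal generated by `E j`. -/
def normalForm (j : ZMod n) : (ℕ →₀ A) →+ Enveloping k A :=
  Finsupp.liftAddHom fun b =>
    { toFun := fun c => left k c * F.U ^ b * F.E j
      map_zero' := by rw [left_zero, zero_mul, zero_mul]
      map_add' := fun c d => by rw [left_add, add_mul, add_mul] }

theorem normalForm_single (j : ZMod n) (b : ℕ) (c : A) :
    F.normalForm j (Finsupp.single b c) = left k c * F.U ^ b * F.E j :=
  Finsupp.liftAddHom_apply_single _ _ _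

theorem normalForm_apply (j : ZMod n) (a : ℕ →₀ A) :
    F.normalForm j a = a.sum fun b c => left k c * F.U ^ b * F.E j := rfl

/-- As the idempotents can be moved across the tensor sign in front of `E j`, the `A`-bimodule
generated by `E j` is generated as a left `A`-module by the elements `(1 ⊗ t ^ b) E j`. -/
theorem exists_normalForm (j : ZMod n) (x : Enveloping k A) :
    ∃ a, F.normalForm j a = x * F.E j := by
  induction x using enveloping_induction with
  | hadd x y hx hy =>
    obtain ⟨a, ha⟩ := hx
    obtain ⟨b, hb⟩ := hy
    exact ⟨a + b, by rw [map_add, ha, hb, add_mul]⟩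
  | hmul c d =>
    induction F.mem_span d using Submodule.span_induction with
    | mem d hd =>
      obtain ⟨⟨i, b⟩, rfl⟩ := hd
      refine ⟨Finsupp.single b (c * F.e (i + j)), ?_⟩
      rw [normalForm_single, right_mul, right_pow, mul_assoc (left k c), mul_assoc (F.U ^ b),
        F.right_e_mul_E, ← F.left_e_mul_E, left_mul, mul_assoc, mul_assoc,
        ← mul_assoc (F.U ^ b), ← mul_assoc (left k (F.e (i + j))),
        ((commute_left_right (F.e (i + j)) F.t).pow_right b).eq]
    | zero =>
      refine ⟨0, ?_⟩
      rw [map_zero, right_zero, mul_zero, zero_mul]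
    | add x y _ _ hx hy =>
      obtain ⟨a, ha⟩ := hx
      obtain ⟨b, hb⟩ := hy
      refine ⟨a + b, ?_⟩
      rw [map_add, ha, hb, right_add, mul_add, add_mul]
    | smul r x _ hx =>
      obtain ⟨a, ha⟩ := hx
      refine ⟨a.mapRange (fun c => algebraMap k A r * c) (mul_zero _), ?_⟩
      have h : ∀ a : ℕ →₀ A, F.normalForm j (a.mapRange (fun c => algebraMap k A r * c)
          (mul_zero _)) = left k (algebraMap k A r) * F.normalForm j a := by
        intro a
        induction a using Finsupp.induction_linear with
        | zero => rw [Finsupp.mapRange_zero, map_zero, mul_zero]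
        | add a b ha hb =>
          rw [Finsupp.mapRange_add (fun _ _ => mul_add _ _ _), map_add, map_add, ha, hb, mul_add]
        | single b c =>
          rw [Finsupp.mapRange_single, normalForm_single, normalForm_single, left_mul]
          simp only [mul_assoc]
      rw [h, ha, ← mul_assoc, ← mul_assoc, ← left_mul]
      rw [right_smul, ← mul_assoc, ← left_mul, Algebra.commutes]

/-- The coefficients of `e i * t ^ b` are well defined on `A`, for all `i`. -/
def HasCoeff (b : ℕ) : Prop :=
  ∀ i, ∃ c : A →ₗ[k] k, ∀ i' b', c (F.e i' * F.t ^ b') = if i' = i ∧ b' = b then 1 else 0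

variable {F}

/-- The coefficients of a normal form are unique in the degrees where `A` has coefficients. -/
theorem HasCoeff.eq_zero {b : ℕ} (hb : F.HasCoeff b) {j : ZMod n} {a : ℕ →₀ A}
    (h : F.normalForm j a = 0) : a b = 0 := by
  have key : ∀ i, a b * F.e (i + j) = 0 := by
    intro i
    obtain ⟨c, hc⟩ := hb i
    let κ : Enveloping k A →ₗ[k] A := (TensorProduct.rid k A).toLinearMap ∘ₗ
      TensorProduct.map LinearMap.id (c ∘ₗ (MulOpposite.opLinearEquiv k).symm.toLinearMap)
    have hκ : ∀ x y : A, κ (left k x * right k y) = c y • x := fun x y => by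
      rw [left_mul_right]
      exact TensorProduct.rid_tmul _ _
    have hn : ∀ a : ℕ →₀ A, κ (F.normalForm j a) = a b * F.e (i + j) := by
      intro a
      induction a using Finsupp.induction_linear with
      | zero => simp
      | add a a' ha ha' => rw [map_add, map_add, ha, ha', Finsupp.add_apply, add_mul]
      | single b' x =>
        have : ∀ i', left k x * F.U ^ b' * (left k (F.e (i' + j)) * right k (F.e i')) =
            left k (x * F.e (i' + j)) * right k (F.e i' * F.t ^ b') := fun i' => by
          rw [left_mul, right_mul, right_pow, mul_assoc, mul_assoc, ← mul_assoc (F.U ^ b'),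
            ← mul_assoc (left k (F.e (i' + j))),
            ((commute_left_right (F.e (i' + j)) F.t).pow_right b').eq]
        rw [normalForm_single, E, Finset.mul_sum, map_sum]
        simp_rw [this, hκ, hc]
        rw [Finset.sum_eq_single i]
        · by_cases hbb : b' = b
          · subst hbb; simp
          · simp [hbb, Finsupp.single_eq_of_ne (Ne.symm hbb)]
        · intro i' _ hi'; simp [hi']
        · simp
    rw [← hn, h, map_zero]
  rw [← mul_one (a b), ← F.sum_e, Finset.mul_sum]
  refine Finset.sum_eq_zero fun i _ => ?_
  rw [← key (i - j), sub_add_cancel]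

variable (F)

theorem normalForm_mul_sub (a : ℕ →₀ A) :
    F.normalForm 1 a * (F.T - F.U) =
      F.normalForm 0 (a.mapRange (· * F.t) (zero_mul _) - a.mapDomain (· + 1)) := by
  induction a using Finsupp.induction_linear with
  | zero => simp
  | add a b ha hb =>
    rw [map_add, add_mul, ha, hb, ← map_add, Finsupp.mapRange_add (fun _ _ => add_mul _ _ _),
      Finsupp.mapDomain_add, add_sub_add_comm]
  | single b c =>
    rw [Finsupp.mapRange_single, Finsupp.mapDomain_single, map_sub, normalForm_single,
      normalForm_single, normalForm_single, mul_assoc, ← zero_add (1 : ZMod n), ← F.sub_mul_E,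
      sub_mul, mul_sub, ← mul_assoc, ← mul_assoc, pow_succ, left_mul]
    congr 2
    · rw [mul_assoc, mul_assoc, ← (F.commute_T_U.pow_right b).eq]
    · rw [mul_assoc]

variable {F}

/-- The coefficients of an element of the kernel of `E 1 ↦ (t ⊗ 1 - 1 ⊗ t) E 0` are determined
recursively, each by the next one. -/
theorem coeff_succ_mul_t {a : ℕ →₀ A} (h : F.normalForm 1 a * (F.T - F.U) = 0) {b : ℕ}
    (hb : F.HasCoeff (b + 1)) : a (b + 1) * F.t = a b := by
  rw [normalForm_mul_sub] at h
  have := hb.eq_zero h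
  rw [Finsupp.sub_apply, Finsupp.mapRange_apply, sub_eq_zero,
    Finsupp.mapDomain_apply (add_left_injective 1)] at this
  exact this

variable (F) in
/-- If `A` has the elements `e i * t ^ b` as a basis, then `E 1 ↦ (t ⊗ 1 - 1 ⊗ t) E 0` is
injective on the left ideal generated by `E 1`. -/
theorem eq_zero_of_mul_sub_eq_zero (hF : ∀ b, F.HasCoeff b) {x : Enveloping k A}
    (h : x * F.E 1 * (F.T - F.U) = 0) : x * F.E 1 = 0 := by
  obtain ⟨a, ha⟩ := F.exists_normalForm 1 x
  rw [← ha] at h ⊢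
  have hs : ∀ c b, a b = a (b + c) * F.t ^ c := by
    intro c
    induction c with
    | zero => simp
    | succ c ih =>
      intro b
      rw [ih, ← coeff_succ_mul_t h (hF (b + c + 1)), mul_assoc, ← pow_succ', add_assoc]
  -- `a b` is a multiple of every later coefficient, and almost all of these vanish
  suffices a = 0 by rw [this, map_zero]
  ext b
  obtain ⟨c, hc⟩ := Infinite.exists_notMem_finset (a.support.image (· - b) ∪ {0})
  rw [hs c b, Finsupp.notMem_support_iff.1, zero_mul]; rfl
  intro h'
  exact hc (Finset.mem_union_left _ (Finset.mem_image.2 ⟨_, h', by omega⟩))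

/-- If `A` has the elements `e i * t ^ b` with `b < l` as a basis, then the kernel of
`E 1 ↦ (t ⊗ 1 - 1 ⊗ t) E 0` on the left ideal generated by `E 1` is generated by the norm
element. -/
theorem exists_eq_mul_N (F : CyclicFrame k n A) {l : ℕ} (hl : F.t ^ l = 0)
    (hF : ∀ b < l, F.HasCoeff b) {x : Enveloping k A} (h : x * F.E 1 * (F.T - F.U) = 0) :
    ∃ c, x * F.E 1 = left k c * F.N l * F.E 1 := by
  obtain ⟨a, ha⟩ := F.exists_normalForm 1 x
  rw [← ha] at h ⊢
  have hs : ∀ c < l, a (l - 1 - c) = a (l - 1) * F.t ^ c := by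
    intro c hc
    induction c with
    | zero => simp
    | succ c ih =>
      have : l - 1 - c = l - 1 - (c + 1) + 1 := by omega
      rw [← coeff_succ_mul_t h (hF _ (by omega)), ← this, ih (by omega), pow_succ, mul_assoc]
  have hU : F.U ^ l = 0 := by rw [← right_pow, hl, right_zero]
  refine ⟨a (l - 1), ?_⟩
  have : F.normalForm 1 a = ∑ b ∈ Finset.range l, left k (a b) * F.U ^ b * F.E 1 := by
    rw [normalForm_apply, Finsupp.sum_of_support_subset _ Finset.subset_union_left
      (s := a.support ∪ Finset.range l) _ (fun b _ => by rw [left_zero, zero_mul, zero_mul])]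
    refine (Finset.sum_subset Finset.subset_union_right fun b _ hb => ?_).symm
    rw [Finset.mem_range, not_lt] at hb
    rw [pow_eq_zero_of_le hb hU, mul_zero, zero_mul]
  rw [this, N, Finset.mul_sum, Finset.sum_mul, ← Finset.sum_range_reflect]
  refine Finset.sum_congr rfl fun c hc => ?_
  rw [hs c (Finset.mem_range.1 hc), left_mul, left_pow, mul_assoc (left k (a (l - 1)))]

/-- The norm element generates a free left `A`-module. -/
theorem eq_zero_of_mul_N_eq_zero (F : CyclicFrame k n A) {l : ℕ} (hl : l ≠ 0)
    (hF : F.HasCoeff (l - 1)) {c : A} (h : left k c * F.N l * F.E 1 = 0) : c = 0 := by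
  -- the coefficient of degree `l - 1` of the normal form of `c N E 1` is `c`
  have : F.normalForm 1 (∑ a ∈ Finset.range l, Finsupp.single (l - 1 - a) (c * F.t ^ a)) = 0 := by
    rw [map_sum, ← h, N, Finset.mul_sum, Finset.sum_mul]
    refine Finset.sum_congr rfl fun a _ => ?_
    rw [normalForm_single, left_mul, left_pow, mul_assoc (left k c)]
  have h0 := hF.eq_zero this
  rw [Finsupp.finsetSum_apply, Finset.sum_eq_single 0] at h0
  · simpa using h0
  · intro a ha ha0
    have := Finset.mem_range.1 ha
    exact Finsupp.single_eq_of_ne (by omega)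
  · intro h; simp at h; exact absurd h hl

end CyclicFrame

/-! ### Left ideals generated by idempotents -/

section CyclicProjective

variable {R : Type u} [Ring R]

/-- The left ideal `R ε` as an `R`-module. -/
def cyclicModule (ε : R) : ModuleCat.{u} R := ModuleCat.of R (Ideal.span {ε})

namespace cyclicModule

variable {ε : R}

/-- The inclusion `R ε ⊆ R`. -/
def val : cyclicModule ε →ₗ[R] R := (Ideal.span {ε}).subtype

variable (ε) in
/-- The generator `ε` of `R ε`. -/
def gen : cyclicModule ε := (⟨ε, Ideal.mem_span_singleton_self ε⟩ : Ideal.span {ε})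

theorem val_injective : Function.Injective (val (ε := ε)) := Subtype.val_injective

theorem val_gen : val (gen ε) = ε := rfl

theorem val_smul_gen (x : R) : val (x • gen ε) = x * ε := map_smul val x (gen ε)

theorem exists_smul_gen (x : cyclicModule ε) : ∃ r : R, r • gen ε = x := by
  obtain ⟨r, hr⟩ := Ideal.mem_span_singleton'.1 (show val x ∈ Ideal.span {ε} from x.2)
  exact ⟨r, val_injective ((val_smul_gen r).trans hr)⟩

theorem smul_gen (hε : ε * ε = ε) : ε • gen ε = gen ε :=
  val_injective ((val_smul_gen ε).trans hε)

/-- The morphism `R ε → M` with `x ↦ x y`. -/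
def lift {M : ModuleCat.{u} R} (y : M) : cyclicModule ε ⟶ M :=
  ModuleCat.ofHom (X := cyclicModule ε) (LinearMap.toSpanSingleton R M y ∘ₗ val)

theorem lift_apply {M : ModuleCat.{u} R} (y : M) (x : cyclicModule ε) :
    (lift y).hom x = val x • y := rfl

theorem lift_gen {M : ModuleCat.{u} R} {y : M} (hy : ε • y = y) : (lift y).hom (gen ε) = y := hy

theorem hom_ext {M : ModuleCat.{u} R} {f g : cyclicModule ε ⟶ M}
    (h : f.hom (gen ε) = g.hom (gen ε)) : f = g := by
  refine ModuleCat.hom_ext (LinearMap.ext fun x => ?_)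
  obtain ⟨r, rfl⟩ := exists_smul_gen x
  rw [map_smul, map_smul, h]

theorem projective (hε : ε * ε = ε) : Projective (cyclicModule ε) := by
  have : Module.Projective R (cyclicModule ε) := by
    refine Module.Projective.of_split (P := cyclicModule ε) (M := R) val
      (LinearMap.toSpanSingleton R _ (gen ε)) (LinearMap.ext fun x => ?_)
    obtain ⟨r, rfl⟩ := exists_smul_gen x
    refine val_injective ?_
    change val (val (r • gen ε) • gen ε) = val (r • gen ε)
    rw [val_smul_gen, val_smul_gen, mul_assoc, hε]
  exact (IsProjective.iff_projective (R := R) (cyclicModule ε : Type u)).1 this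

end cyclicModule

theorem ModuleCat.shortExact_mk {X Y Z : ModuleCat.{u} R} {f : X ⟶ Y} {g : Y ⟶ Z} (w : f ≫ g = 0)
    (hf : Function.Injective f.hom) (hg : Function.Surjective g.hom)
    (h : ∀ y, g.hom y = 0 → ∃ x, f.hom x = y) : (ShortComplex.mk f g w).ShortExact :=
  have := (ModuleCat.mono_iff_injective f).2 hf
  have := (ModuleCat.epi_iff_surjective g).2 hg
  .mk ((ShortComplex.moduleCat_exact_iff _).2 h)

end CyclicProjective

/-! ### The regular bimodule -/

section RegularBimodule

open CyclicFrame

variable {k : Type u} [Field k] {A : Type u} [Ring A] [Algebra k A]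

variable (k) in
/-- An element of `A` as an element of the regular bimodule. -/
def toRegular : A ≃+ regularBimodule k A := AddEquiv.refl A

theorem left_zero_smul {M : ModuleCat.{u} (Enveloping k A)} (m : M) : left k (0 : A) • m = 0 :=
  (congrArg (· • m) left_zero).trans (zero_smul (Enveloping k A) m)

theorem left_smul_toRegular (a x : A) : left k a • toRegular k x = toRegular k (a * x) :=
  (regularBimodule_tmul_smul (k := k) a 1 x).trans (mul_one _)

theorem right_smul_toRegular (a x : A) : right k a • toRegular k x = toRegular k (x * a) :=
  (regularBimodule_tmul_smul (k := k) 1 a x).trans (congrArg (· * a) (one_mul x))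

variable {M : ModuleCat.{u} (Enveloping k A)}

theorem left_symm_smul_smul {m : M} (hm : ∀ a : A, left k a • m = right k a • m)
    (r : Enveloping k A) (x : regularBimodule k A) :
    left k ((toRegular k).symm (r • x)) • m = r • left k ((toRegular k).symm x) • m := by
  obtain ⟨x, rfl⟩ := (toRegular k).surjective x
  rw [AddEquiv.symm_apply_apply]
  induction r using enveloping_induction with
  | hadd r s hr hs => rw [add_smul, add_smul, map_add, left_add, add_smul, hr, hs]
  | hmul c d =>
    rw [mul_smul, right_smul_toRegular, left_smul_toRegular, AddEquiv.symm_apply_apply,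
      left_mul, left_mul, mul_smul, mul_smul, hm d, mul_smul, ← mul_smul (left k x),
      (commute_left_right x d).eq, mul_smul]

/-- The bimodule morphism `A → M` with `1 ↦ m`, for an element `m` with `a m = m a` for all `a`. -/
def liftCentral (m : M) (hm : ∀ a : A, left k a • m = right k a • m) :
    regularBimodule k A ⟶ M :=
  ModuleCat.ofHom (X := regularBimodule k A) (Y := M)
    { toFun := fun x => left k ((toRegular k).symm x) • m
      map_add' := fun _ _ =>
        (congrArg (· • m) ((congrArg (left k) (map_add _ _ _)).trans (left_add _ _))).trans
          (add_smul _ _ _)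
      map_smul' := left_symm_smul_smul hm }

theorem regularBimodule_hom_ext {f g : regularBimodule k A ⟶ M}
    (h : f.hom (toRegular k 1) = g.hom (toRegular k 1)) : f = g := by
  refine ModuleCat.hom_ext (LinearMap.ext fun x => ?_)
  obtain ⟨x, rfl⟩ := (toRegular k).surjective x
  rw [← mul_one x, ← left_smul_toRegular, f.hom.map_smul, g.hom.map_smul, h]

theorem centerEnd_one_apply (z : Subalgebra.center k A) :
    (centerEnd z).hom (toRegular k 1) = toRegular k (z : A) := mul_one (z : A)

theorem centerClass_bijective : Function.Bijective (centerClass (k := k) (A := A)) := by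
  refine (Ext.mk₀_bijective _ _).comp ⟨fun y z h => Subtype.ext ((toRegular k).injective ?_),
    fun f => ?_⟩
  · rw [← centerEnd_one_apply, ← centerEnd_one_apply, h]
  · obtain ⟨z, hz⟩ := (toRegular k).surjective (f.hom (toRegular k 1))
    have hc : z ∈ Subalgebra.center k A := by
      refine Subalgebra.mem_center_iff.2 fun a => (toRegular k).injective ?_
      rw [← left_smul_toRegular, ← right_smul_toRegular, hz, ← f.hom.map_smul,
        ← f.hom.map_smul, left_smul_toRegular, right_smul_toRegular, mul_one, one_mul]
    exact ⟨⟨z, hc⟩, regularBimodule_hom_ext ((centerEnd_one_apply _).trans hz)⟩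

/-- Multiplication by a central element, as an endomorphism of any bimodule. -/
def centralEnd (z : Subalgebra.center k A) (M : ModuleCat.{u} (Enveloping k A)) : M ⟶ M :=
  ModuleCat.ofHom
    { toFun := fun x => left k (z : A) • x
      map_add' := smul_add _
      map_smul' := fun r x => by
        have h : left k (z : A) * r = r * left k (z : A) := by
          induction r using enveloping_induction with
          | hadd r s hr hs => rw [mul_add, add_mul, hr, hs]
          | hmul c d =>
            rw [← mul_assoc, ← left_mul, ← Subalgebra.mem_center_iff.1 z.2, left_mul, mul_assoc,
              mul_assoc, (commute_left_right _ _).eq]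
        rw [RingHom.id_apply, ← mul_smul, ← mul_smul, h] }

theorem centralEnd_regularBimodule (z : Subalgebra.center k A) :
    centralEnd z (regularBimodule k A) = centerEnd z :=
  regularBimodule_hom_ext (left_smul_toRegular (z : A) 1)

theorem centralEnd_naturality (z : Subalgebra.center k A) {M N : ModuleCat.{u} (Enveloping k A)}
    (f : M ⟶ N) : centralEnd z M ≫ f = f ≫ centralEnd z N :=
  ModuleCat.hom_ext (LinearMap.ext fun x => map_smul f.hom (left k (z : A)) x)

theorem extClass_comp_centralEnd (z : Subalgebra.center k A)
    {S : ShortComplex (ModuleCat.{u} (Enveloping k A))} (hS : S.ShortExact) :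
    hS.extClass.comp (Ext.mk₀ (centralEnd z S.X₁)) (add_zero 1) =
      (Ext.mk₀ (centralEnd z S.X₃)).comp hS.extClass (zero_add 1) :=
  hS.extClass_naturality hS
    { τ₁ := centralEnd z _
      τ₂ := centralEnd z _
      τ₃ := centralEnd z _
      comm₁₂ := centralEnd_naturality z _
      comm₂₃ := centralEnd_naturality z _ }

end RegularBimodule

/-! ### Projective resolutions from cyclic frames -/

namespace CyclicFrame

open cyclicModule

variable {k : Type u} [Field k] {n : ℕ} [NeZero n] {A : Type u} [Ring A] [Algebra k A]
variable (F : CyclicFrame k n A)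

/-- The projective bimodule generated by `E j`. -/
abbrev P (j : ZMod n) : ModuleCat.{u} (Enveloping k A) := cyclicModule (F.E j)

theorem projective_P (j : ZMod n) : Projective (F.P j) := cyclicModule.projective (F.E_mul_self j)

theorem E_smul_gen (j : ZMod n) : F.E j • gen (F.E j) = gen (F.E j) :=
  smul_gen (F.E_mul_self j)

/-- An element of a bimodule that commutes with the idempotents and with `t` is central. -/
theorem left_smul_eq_right_smul {M : ModuleCat.{u} (Enveloping k A)} (m : M)
    (he : ∀ i, left k (F.e i) • m = right k (F.e i) • m) (ht : F.T • m = F.U • m) (a : A) :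
    left k a • m = right k a • m := by
  have hmul : ∀ a b : A, left k a • m = right k a • m → left k b • m = right k b • m →
      left k (a * b) • m = right k (a * b) • m := fun a b ha hb => by
    rw [left_mul, right_mul, mul_smul, mul_smul, hb, ← ha, ← mul_smul, ← mul_smul,
      (commute_left_right a b).eq]
  induction F.mem_span a using Submodule.span_induction with
  | mem a ha =>
    obtain ⟨⟨i, b⟩, rfl⟩ := ha
    refine hmul _ _ (he i) ?_
    dsimp only
    induction b with
    | zero => rw [pow_zero]; rfl
    | succ b ih => rw [pow_succ]; exact hmul _ _ ih ht
  | zero => exact congrArg (· • m) ((TensorProduct.zero_tmul _ _).trans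
      (TensorProduct.tmul_zero _ _).symm)
  | add a b _ _ ha hb =>
    rw [right_add, left_add,
      add_smul, add_smul, ha, hb]
  | smul r a _ ha =>
    rw [right_smul, Algebra.smul_def, left_mul, mul_smul, mul_smul, ha]

theorem E_zero_smul_one : F.E 0 • toRegular k (1 : A) = toRegular k 1 := by
  rw [E, Finset.sum_smul]
  simp_rw [mul_smul, right_smul_toRegular, left_smul_toRegular, one_mul, add_zero, F.e_mul_self]
  rw [← map_sum, F.sum_e]

/-- The multiplication `A ⊗ A → A`, restricted to `P 0`. -/
def aug : F.P 0 ⟶ regularBimodule k A := lift (toRegular k 1)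

theorem aug_gen : F.aug.hom (gen (F.E 0)) = toRegular k 1 := F.E_zero_smul_one

theorem aug_surjective : Function.Surjective F.aug.hom := fun x => by
  obtain ⟨x, rfl⟩ := (toRegular k).surjective x
  exact ⟨left k x • gen (F.E 0), by
    rw [map_smul, F.aug_gen, left_smul_toRegular, mul_one]⟩

/-- The differential `P 1 → P 0` with `E 1 ↦ t E 0 - E 0 t`. -/
def d : F.P 1 ⟶ F.P 0 := lift ((F.T - F.U) • gen (F.E 0))

theorem E_one_smul : F.E 1 • (F.T - F.U) • gen (F.E 0) = (F.T - F.U) • gen (F.E 0) := by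
  conv_lhs => rw [← mul_smul, ← zero_add (1 : ZMod n), ← F.sub_mul_E, mul_smul, F.E_smul_gen]

theorem d_gen : F.d.hom (gen (F.E 1)) = (F.T - F.U) • gen (F.E 0) := lift_gen F.E_one_smul

theorem val_d (x : F.P 1) : val (F.d.hom x) = val x * (F.T - F.U) := by
  obtain ⟨r, rfl⟩ := exists_smul_gen x
  rw [map_smul, d_gen, ← mul_smul, val_smul_gen, val_smul_gen, mul_assoc, mul_assoc, F.sub_mul_E,
    zero_add]

theorem d_aug : F.d ≫ F.aug = 0 := by
  refine hom_ext ?_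
  rw [ModuleCat.hom_comp, LinearMap.comp_apply, d_gen, map_smul, aug_gen, sub_smul,
    left_smul_toRegular, right_smul_toRegular, mul_one, one_mul, sub_self]
  rfl

theorem exists_d_eq {x : F.P 0} (hx : F.aug.hom x = 0) : ∃ y, F.d.hom y = x := by
  -- modulo the image of `d`, the factor `1 ⊗ t ^ b` can be replaced by `t ^ b ⊗ 1`
  have key : ∀ a : ℕ →₀ A, ∃ (y : F.P 1) (c : A),
      val (F.d.hom y) + F.normalForm 0 a = left k c * F.E 0 := by
    intro a
    induction a using Finsupp.induction_linear with
    | zero => exact ⟨0, 0, by rw [map_zero, map_zero, map_zero, left_zero, zero_mul, add_zero]⟩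
    | add a b ha hb =>
      obtain ⟨y, c, h⟩ := ha
      obtain ⟨y', c', h'⟩ := hb
      exact ⟨y + y', c + c', by
        rw [map_add, map_add, map_add, left_add, add_mul, ← h, ← h', add_add_add_comm]⟩
    | single b c =>
      refine ⟨(left k c * F.N b) • gen (F.E 1), c * F.t ^ b, ?_⟩
      rw [map_smul, d_gen, ← mul_smul, val_smul_gen, normalForm_single, mul_assoc (left k c),
        F.N_mul_sub, ← add_mul, mul_sub, sub_add_cancel, left_mul, left_pow]
  obtain ⟨r, rfl⟩ := exists_smul_gen x
  obtain ⟨a, ha⟩ := F.exists_normalForm 0 r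
  obtain ⟨y, c, h⟩ := key a
  have h1 : F.d.hom y + r • gen (F.E 0) = left k c • gen (F.E 0) := val_injective (by
    rw [map_add, val_smul_gen, val_smul_gen, ← ha, h])
  have h2 : F.aug.hom (F.d.hom y) = 0 := congrArg (fun f => f.hom y) F.d_aug
  have h3 : toRegular k c = 0 := by
    rw [← mul_one c, ← left_smul_toRegular, ← F.aug_gen, ← F.aug.hom.map_smul, ← h1, map_add, h2,
      hx, add_zero]
  rw [EmbeddingLike.map_eq_zero_iff] at h3
  rw [h3, left_zero_smul] at h1
  exact ⟨-y, by rw [map_neg]; exact neg_eq_of_add_eq_zero_right h1⟩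

theorem d_injective (hF : ∀ b, F.HasCoeff b) : Function.Injective F.d.hom := by
  rw [injective_iff_map_eq_zero]
  intro x hx
  obtain ⟨r, rfl⟩ := exists_smul_gen x
  refine val_injective ?_
  rw [map_zero, val_smul_gen]
  refine eq_zero_of_mul_sub_eq_zero F hF ?_
  have := F.val_d (r • gen (F.E 1))
  rw [hx, map_zero, val_smul_gen] at this
  exact this.symm

/-- A bimodule resolution of length one if the elements `e i * t ^ b` form a basis of `A`. -/
theorem shortExact_d_aug (hF : ∀ b, F.HasCoeff b) :
    (ShortComplex.mk F.d F.aug F.d_aug).ShortExact :=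
  ModuleCat.shortExact_mk _ (F.d_injective hF) F.aug_surjective fun _ => F.exists_d_eq

end CyclicFrame

/-! ### First cohomology from a cyclic frame -/

namespace CyclicFrame

open cyclicModule

variable {k : Type u} [Field k] {n : ℕ} [NeZero n] {A : Type u} [Ring A] [Algebra k A]
variable (F : CyclicFrame k n A)

theorem d_lift {M : ModuleCat.{u} (Enveloping k A)} (x : M) :
    F.d ≫ (lift x : F.P 0 ⟶ M) = lift ((F.T - F.U) • x) := by
  refine hom_ext ?_
  rw [ModuleCat.hom_comp, LinearMap.comp_apply, d_gen, map_smul, lift_apply, lift_apply, val_gen,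
    val_gen, ← mul_smul, ← mul_smul, F.sub_mul_E, zero_add]

/-- The first cohomology `Ext^1(A, M)` as a quotient of `M`, where `y` represents the class of the
cocycle `E 1 ↦ E 1 y`, and the relations are the coboundaries `t x - x t`. The module `K` is the
image of `P 1` in `P 0`, presented as a quotient `p` of `P 1`. -/
theorem exists_extOne_presentation {K M : ModuleCat.{u} (Enveloping k A)} {i : K ⟶ F.P 0}
    {w : i ≫ F.aug = 0} (hS : (ShortComplex.mk i F.aug w).ShortExact) (p : F.P 1 ⟶ K) [Epi p]
    (hp : p ≫ i = F.d) (hM : ∀ f : F.P 1 ⟶ M, ∃ g, p ≫ g = f) :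
    ∃ κ : M →+ Ext.{u} (regularBimodule k A) M 1, Function.Surjective κ ∧
      (∀ (c : M ⟶ M) (y : M), (κ y).comp (Ext.mk₀ c) (add_zero 1) = κ (c.hom y)) ∧
      ∀ y, κ y = 0 ↔ ∃ x : M, F.E 1 • y = F.E 1 • (F.T - F.U) • x := by
  have := F.projective_P 0
  choose g hg using fun y : M => hM (lift y)
  have huniq : ∀ (y : M) (g' : K ⟶ M), p ≫ g' = lift y → g y = g' := fun y g' h => by
    rw [← cancel_epi p, hg, h]
  have hadd : ∀ x y, g (x + y) = g x + g y := fun x y => huniq _ _ (by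
    rw [Preadditive.comp_add, hg, hg]
    refine hom_ext ?_
    rw [ModuleCat.hom_add, LinearMap.add_apply, lift_apply, lift_apply, lift_apply, smul_add])
  refine ⟨AddMonoidHom.mk' (fun y => hS.extClass.comp (Ext.mk₀ (g y)) (add_zero 1)) fun x y => by
    rw [hadd, Ext.mk₀_add, Ext.comp_add], fun x => ?_, fun c y => ?_, fun y => ?_⟩
  · have : Projective (ShortComplex.mk i F.aug w).X₂ := F.projective_P 0
    obtain ⟨f, rfl⟩ := hS.exists_extClass_comp_mk₀ x
    refine ⟨(p ≫ f).hom (gen (F.E 1)), ?_⟩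
    change hS.extClass.comp (Ext.mk₀ (g _)) (add_zero 1) = _
    rw [huniq _ f]
    refine hom_ext ?_
    rw [lift_gen]
    rw [← map_smul, F.E_smul_gen]
  · change (hS.extClass.comp (Ext.mk₀ (g _)) (add_zero 1)).comp _ _ =
      hS.extClass.comp (Ext.mk₀ (g _)) (add_zero 1)
    rw [huniq (c.hom y) (g y ≫ c), Ext.comp_assoc _ _ _ (add_zero 1) (add_zero 0) rfl,
      Ext.mk₀_comp_mk₀]
    rw [← Category.assoc, hg]
    refine hom_ext ?_
    rw [ModuleCat.hom_comp, LinearMap.comp_apply, lift_apply, lift_apply, map_smul]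
  · change hS.extClass.comp (Ext.mk₀ (g _)) (add_zero 1) = 0 ↔ _
    rw [hS.extClass_comp_mk₀_eq_zero_iff]
    constructor
    · rintro ⟨f, hf⟩
      refine ⟨f.hom (gen (F.E 0)), ?_⟩
      have h : F.d ≫ f = lift y := by rw [← hp, ← hg y, ← hf, Category.assoc]
      have h' := congrArg (fun f => f.hom (gen (F.E 1))) h
      rw [ModuleCat.hom_comp, LinearMap.comp_apply, d_gen, map_smul, lift_apply, val_gen] at h'
      rw [h', ← mul_smul, F.E_mul_self]
    · rintro ⟨x, hx⟩
      refine ⟨lift x, ?_⟩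
      change i ≫ lift x = g y
      rw [← cancel_epi p, hg, ← Category.assoc, hp, d_lift]
      refine hom_ext ?_
      rw [lift_apply, lift_apply, val_gen, hx]

/-! ### The periodic resolution of a truncated algebra -/

/-- The elements `e i * t ^ b` with `b < l` form a basis of `A`, while `t ^ l = 0`, and `t ^ l`
maps every vertex to itself. There are at least two vertices. -/
structure IsTruncated (l : ℕ) : Prop where
  one_ne_zero : (1 : ZMod n) ≠ 0
  pos : 0 < l
  t_pow : F.t ^ l = 0
  natCast_eq_zero : (l : ZMod n) = 0
  hasCoeff : ∀ b < l, F.HasCoeff b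

theorem exists_t_pow_mul (b : ℕ) (x : A) : ∃ y, F.t ^ b * x = y * F.t ^ b := by
  induction F.mem_span x using Submodule.span_induction with
  | mem x hx =>
    obtain ⟨⟨i, c⟩, rfl⟩ := hx
    refine ⟨F.e (i + b) * F.t ^ c, ?_⟩
    dsimp only
    rw [← mul_assoc, F.t_pow_mul_e, mul_assoc, mul_assoc, ← pow_add, ← pow_add, add_comm b c]
  | zero => exact ⟨0, by simp⟩
  | add x y _ _ hx hy =>
    obtain ⟨x', hx⟩ := hx
    obtain ⟨y', hy⟩ := hy
    exact ⟨x' + y', by rw [mul_add, add_mul, hx, hy]⟩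
  | smul r x _ hx =>
    obtain ⟨x', hx⟩ := hx
    exact ⟨r • x', by rw [mul_smul_comm, smul_mul_assoc, hx]⟩

theorem E_smul_toRegular (j : ZMod n) (x : A) :
    F.E j • toRegular k x = toRegular k (∑ i, F.e (i + j) * x * F.e i) := by
  rw [E, Finset.sum_smul, map_sum]
  refine Finset.sum_congr rfl fun i _ => ?_
  rw [mul_smul, right_smul_toRegular, left_smul_toRegular, mul_assoc]

theorem right_e_smul_gen (i : ZMod n) :
    right k (F.e i) • gen (F.E 0) = left k (F.e i) • gen (F.E 0) := val_injective (by
  have := F.left_e_mul_E i 0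
  rw [add_zero] at this
  rw [val_smul_gen, val_smul_gen, F.right_e_mul_E, add_zero, this])

theorem E_smul_left_smul_gen (j : ZMod n) (x : A) :
    F.E j • left k x • gen (F.E 0) =
      left k (∑ i, F.e (i + j) * x * F.e i) • gen (F.E 0) := by
  have : left k (∑ i, F.e (i + j) * x * F.e i) = ∑ i, left k (F.e (i + j) * x * F.e i) :=
    TensorProduct.sum_tmul _ _ _
  rw [this, show F.E j = ∑ i, left k (F.e (i + j)) * right k (F.e i) from rfl, Finset.sum_smul,
    Finset.sum_smul]
  refine Finset.sum_congr rfl fun i _ => ?_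
  rw [left_mul, left_mul, mul_smul, mul_smul, mul_smul, ← F.right_e_smul_gen, ← mul_smul,
    ← mul_smul, ← mul_smul, mul_assoc, ← (commute_left_right x _).eq, ← mul_smul, mul_assoc]

namespace IsTruncated

variable {F} {l : ℕ} (hF : F.IsTruncated l)
include hF

theorem t_pow_mul_mul_t_pow {a b : ℕ} (h : l ≤ a + b) (x : A) : F.t ^ a * x * F.t ^ b = 0 := by
  obtain ⟨y, hy⟩ := F.exists_t_pow_mul a x
  rw [hy, mul_assoc, ← pow_add, pow_eq_zero_of_le h hF.t_pow, mul_zero]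

/-- As there are at least two vertices, elements of degree one are multiples of `t`. -/
theorem exists_E_one_smul (x : A) : ∃ y, F.E 1 • toRegular k x = toRegular k (y * F.t) := by
  induction F.mem_span x using Submodule.span_induction with
  | mem x hx =>
    obtain ⟨⟨i, b⟩, rfl⟩ := hx
    rw [E_smul_toRegular]
    cases b with
    | zero =>
      refine ⟨0, ?_⟩
      rw [zero_mul]
      congr 1
      refine Finset.sum_eq_zero fun j _ => ?_
      dsimp only
      rw [pow_zero, mul_one, F.e_mul_e]
      split_ifs with h
      · rw [F.e_mul_e, if_neg]
        simpa using hF.one_ne_zero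
      · rw [zero_mul]
    | succ b =>
      refine ⟨∑ j, F.e (j + 1) * (F.e i * F.t ^ b) * F.e (j + 1), ?_⟩
      rw [Finset.sum_mul]
      congr 1
      refine Finset.sum_congr rfl fun j _ => ?_
      dsimp only
      rw [mul_assoc _ (F.e (j + 1)), F.e_mul_t, pow_succ]
      simp only [mul_assoc]
  | zero => exact ⟨0, by rw [map_zero, smul_zero, zero_mul, map_zero]⟩
  | add x y _ _ hx hy =>
    obtain ⟨x', hx⟩ := hx
    obtain ⟨y', hy⟩ := hy
    exact ⟨x' + y', by rw [map_add, smul_add, hx, hy, add_mul, map_add]⟩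
  | smul r x _ hx =>
    obtain ⟨x', hx⟩ := hx
    refine ⟨algebraMap k A r * x', ?_⟩
    rw [E_smul_toRegular] at hx ⊢
    rw [mul_assoc, ← (toRegular k).injective hx, Finset.mul_sum]
    congr 1
    refine Finset.sum_congr rfl fun i _ => ?_
    rw [mul_smul_comm, smul_mul_assoc, Algebra.smul_def]

theorem T_pow_eq_zero : F.T ^ l = 0 := by rw [← left_pow, hF.t_pow, left_zero]

theorem U_pow_eq_zero : F.U ^ l = 0 := by
  rw [← right_pow, hF.t_pow, right_zero]

theorem N_mul_E_one : F.N l * F.E 1 = F.E 0 * F.N l := by rw [F.N_mul_E, hF.natCast_eq_zero]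

theorem N_smul_toRegular_mul_t (z : A) : F.N l • toRegular k (z * F.t) = 0 := by
  rw [N, Finset.sum_smul]
  refine Finset.sum_eq_zero fun a ha => ?_
  have := Finset.mem_range.1 ha
  rw [mul_smul, ← left_pow, ← right_pow, right_smul_toRegular, left_smul_toRegular, mul_assoc z,
    ← pow_succ', ← mul_assoc, hF.t_pow_mul_mul_t_pow (by omega), map_zero]

theorem left_smul_N (a : A) :
    left k a • F.N l • gen (F.E 1) = right k a • F.N l • gen (F.E 1) := by
  refine F.left_smul_eq_right_smul (M := F.P 1) (F.N l • gen (F.E 1)) (fun i => ?_) ?_ a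
  · have := F.left_e_mul_E i 0
    rw [add_zero] at this
    refine val_injective ?_
    rw [← mul_smul, ← mul_smul, val_smul_gen, val_smul_gen, mul_assoc, mul_assoc, hF.N_mul_E_one,
      ← mul_assoc, ← mul_assoc, this, F.right_e_mul_E, add_zero]
  · rw [← sub_eq_zero, ← sub_smul, ← mul_smul, F.sub_mul_N, hF.T_pow_eq_zero, hF.U_pow_eq_zero]
    refine val_injective ?_
    rw [val_smul_gen, sub_self, zero_mul, map_zero]

/-- The embedding `A → P 1` as the bimodule generated by the norm element. -/
def j : regularBimodule k A ⟶ F.P 1 := liftCentral (F.N l • gen (F.E 1)) hF.left_smul_N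

theorem j_apply (x : A) : hF.j.hom (toRegular k x) = left k x • F.N l • gen (F.E 1) := rfl

theorem j_injective : Function.Injective hF.j.hom := by
  rw [injective_iff_map_eq_zero]
  intro x hx
  obtain ⟨x, rfl⟩ := (toRegular k).surjective x
  rw [j_apply, ← mul_smul] at hx
  rw [F.eq_zero_of_mul_N_eq_zero hF.pos.ne' (hF.hasCoeff _ (Nat.sub_lt hF.pos one_pos)) (c := x),
    map_zero]
  rw [← val_smul_gen, hx, map_zero]

/-- Bimodule morphisms `P 1 → A` vanish on the norm element, for degree reasons. -/
theorem j_comp_eq_zero (f : F.P 1 ⟶ regularBimodule k A) : hF.j ≫ f = 0 := by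
  refine regularBimodule_hom_ext ?_
  obtain ⟨y, hy⟩ := (toRegular k).surjective (f.hom (gen (F.E 1)))
  obtain ⟨z, hz⟩ := hF.exists_E_one_smul y
  rw [hy, ← map_smul, F.E_smul_gen] at hz
  rw [ModuleCat.hom_comp, LinearMap.comp_apply, j_apply, map_smul, map_smul, hz,
    hF.N_smul_toRegular_mul_t, smul_zero]
  rfl

end IsTruncated

/-- The kernel of the multiplication `P 0 → A`. -/
def K : ModuleCat.{u} (Enveloping k A) := ModuleCat.of _ (LinearMap.ker F.aug.hom)

/-- The inclusion `K → P 0`. -/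
def i : F.K ⟶ F.P 0 := ModuleCat.ofHom (X := F.K) (LinearMap.ker F.aug.hom).subtype

theorem i_injective : Function.Injective F.i.hom := Subtype.val_injective

theorem i_aug : F.i ≫ F.aug = 0 := ModuleCat.hom_ext (LinearMap.ext fun x => x.2)

instance : Mono F.i := (ModuleCat.mono_iff_injective _).2 F.i_injective

/-- A morphism to `P 0` that vanishes in `A`, as a morphism to `K`. -/
def liftK {M : ModuleCat.{u} (Enveloping k A)} (f : M ⟶ F.P 0) (hf : f ≫ F.aug = 0) : M ⟶ F.K :=
  ModuleCat.ofHom (Y := F.K) (f.hom.codRestrict (LinearMap.ker F.aug.hom) fun x =>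
    LinearMap.mem_ker.2 (congrArg (fun g => g.hom x) hf))

/-- The differential `P 1 → P 0`, corestricted to its image `K`. -/
def p : F.P 1 ⟶ F.K := F.liftK F.d F.d_aug

theorem p_i : F.p ≫ F.i = F.d := rfl

theorem p_surjective : Function.Surjective F.p.hom := fun x => by
  obtain ⟨y, hy⟩ := F.exists_d_eq (x := F.i.hom x) x.2
  exact ⟨y, F.i_injective hy⟩

instance : Epi F.p := (ModuleCat.epi_iff_surjective _).2 F.p_surjective

instance : Epi F.aug := (ModuleCat.epi_iff_surjective _).2 F.aug_surjective

/-- The short complex `K → P 0 → A`. -/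
abbrev S₀ : ShortComplex (ModuleCat.{u} (Enveloping k A)) := ShortComplex.mk F.i F.aug F.i_aug

theorem shortExact_S₀ : F.S₀.ShortExact :=
  ModuleCat.shortExact_mk _ F.i_injective F.aug_surjective fun y hy => ⟨⟨y, hy⟩, rfl⟩

instance : Projective F.S₀.X₂ := F.projective_P 0

namespace IsTruncated

variable {F} {l : ℕ} (hF : F.IsTruncated l)
include hF

theorem j_p : hF.j ≫ F.p = 0 := by
  rw [← cancel_mono F.i, Category.assoc, F.p_i, Limits.zero_comp]
  refine regularBimodule_hom_ext (val_injective ?_)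
  rw [ModuleCat.hom_comp, LinearMap.comp_apply, val_d, j_apply, map_smul, val_smul_gen,
    hF.N_mul_E_one, smul_eq_mul, mul_assoc, mul_assoc, F.N_mul_sub, hF.T_pow_eq_zero,
    hF.U_pow_eq_zero, sub_self, mul_zero, mul_zero]
  rfl

/-- The short complex `A → P 1 → K`. -/
abbrev S₁ : ShortComplex (ModuleCat.{u} (Enveloping k A)) := ShortComplex.mk hF.j F.p hF.j_p

/-- The kernel of the differential is generated by the norm element, which gives a copy of `A`. -/
theorem shortExact_S₁ : hF.S₁.ShortExact := by
  refine ModuleCat.shortExact_mk _ hF.j_injective F.p_surjective fun y hy => ?_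
  obtain ⟨r, rfl⟩ := exists_smul_gen y
  have h := F.val_d (r • gen (F.E 1))
  rw [← F.p_i, ModuleCat.hom_comp, LinearMap.comp_apply, hy, map_zero, map_zero,
    val_smul_gen] at h
  obtain ⟨c, hc⟩ := F.exists_eq_mul_N hF.t_pow hF.hasCoeff h.symm
  refine ⟨toRegular k c, val_injective ?_⟩
  rw [j_apply, ← mul_smul, val_smul_gen, val_smul_gen, hc]

instance : Projective hF.S₁.X₂ := F.projective_P 1

/-- The class of `0 → A → P 1 → P 0 → A → 0`. -/
def zeta : HHdeg k A 2 := F.shortExact_S₀.extClass.comp hF.shortExact_S₁.extClass rfl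

theorem zeta_comp {M : ModuleCat.{u} (Enveloping k A)} {p q r : ℕ}
    (x : Ext.{u} (regularBimodule k A) M p) (h : 2 + p = r) (hpq : 1 + p = q) (hqr : 1 + q = r) :
    hF.zeta.comp x h =
      F.shortExact_S₀.extClass.comp (hF.shortExact_S₁.extClass.comp x hpq) hqr :=
  Ext.comp_assoc _ _ _ rfl hpq (by omega)

/-- The class of the periodic resolution is a periodicity operator, in degree zero as well because
morphisms `P 1 → A` vanish on the image of `A`. -/
theorem mulRightTwo_zeta_bijective (p : ℕ) : Function.Bijective (HH.mulRightTwo hF.zeta p) := by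
  constructor
  · rw [injective_iff_map_eq_zero]
    intro x hx
    have hx' : hF.shortExact_S₁.extClass.comp x (add_comm 1 p) = 0 :=
      F.shortExact_S₀.extClass_comp_injective (by omega)
        ((hF.zeta_comp x (add_comm 2 p) (add_comm 1 p) (by omega)).symm.trans hx)
    cases p with
    | zero =>
      obtain ⟨f, rfl⟩ := (Ext.mk₀_bijective _ _).2 x
      obtain ⟨g, hg⟩ := (hF.shortExact_S₁.extClass_comp_mk₀_eq_zero_iff f).1 hx'
      rw [← hg, show hF.S₁.f ≫ g = 0 from hF.j_comp_eq_zero g, Ext.mk₀_zero]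
    | succ p => exact hF.shortExact_S₁.extClass_comp_injective _ hx'
  · intro x
    obtain ⟨y, rfl⟩ := F.shortExact_S₀.extClass_comp_surjective (n := p + 1) (by omega) x
    obtain ⟨z, rfl⟩ := hF.shortExact_S₁.extClass_comp_surjective (n := p) (by omega) y
    exact ⟨z, hF.zeta_comp z (add_comm 2 p) _ _⟩

end IsTruncated

end CyclicFrame

/-! ### Products of classes of degree one -/

namespace HH

variable {k : Type u} [Field k] {A : Type u} [Ring A] [Algebra k A]

/-- Commutation may be checked on Yoneda composites; no sign is involved. -/
theorem commute_of {p q r : ℕ} {x : HHdeg k A p} {y : HHdeg k A q} (h : p + q = r)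
    (h' : q + p = r) (hxy : Ext.comp x y h = Ext.comp y x h') : Commute (of p x) (of q y) := by
  subst h'
  rw [commute_iff_eq, of_mul_of, of_mul_of]
  change _ = of (q + p) (Ext.comp x y h)
  rw [hxy]
  exact DirectSum.of_eq_of_gradedMonoid_eq (A := fun p => HHdeg k A p)
    (HHdeg_mk_comp y x (add_comm q p) rfl)

end HH

namespace CyclicFrame

open cyclicModule

variable {k : Type u} [Field k] {n : ℕ} [NeZero n] {A : Type u} [Ring A] [Algebra k A]
variable (F : CyclicFrame k n A)

/-- The coefficients of the homotopy attached to the derivation with `t ↦ z t`. -/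
def homotopyCoeff (z : A) (c : ℕ) : A := ∑ a ∈ Finset.range c, -(F.t ^ a * z * F.t ^ (c - a))

theorem t_mul_homotopyCoeff (z : A) (c : ℕ) :
    F.t * F.homotopyCoeff z c = F.homotopyCoeff z (c + 1) + z * F.t ^ (c + 1) := by
  rw [homotopyCoeff, homotopyCoeff, Finset.sum_range_succ', Finset.mul_sum, pow_zero, one_mul,
    Nat.sub_zero, neg_add_cancel_right]
  refine Finset.sum_congr rfl fun a _ => ?_
  rw [Nat.add_sub_add_right, pow_succ', mul_neg, mul_assoc, mul_assoc, mul_assoc]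

theorem homotopyCoeff_mul_t (z : A) (c : ℕ) :
    F.homotopyCoeff z c * F.t = F.homotopyCoeff z (c + 1) + F.t ^ c * (z * F.t) := by
  rw [homotopyCoeff, homotopyCoeff, Finset.sum_range_succ, Finset.sum_mul, Nat.add_sub_cancel_left,
    pow_one, mul_assoc (F.t ^ c), neg_add_cancel_right]
  refine Finset.sum_congr rfl fun a ha => ?_
  have := Finset.mem_range.1 ha
  rw [neg_mul, mul_assoc _ _ F.t, ← pow_succ, Nat.sub_add_comm this.le]

/-- The homotopy attached to the derivation with `t ↦ z t`. -/
def homotopy (l : ℕ) (z : A) : Enveloping k A :=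
  ∑ c ∈ Finset.range l, left k (F.homotopyCoeff z c) * F.U ^ (l - 1 - c)

variable {F} {l : ℕ}

namespace IsTruncated

variable (hF : F.IsTruncated l)
include hF

theorem homotopyCoeff_self (z : A) : F.homotopyCoeff z l = 0 := by
  refine Finset.sum_eq_zero fun a ha => ?_
  have := Finset.mem_range.1 ha
  rw [hF.t_pow_mul_mul_t_pow (by omega), neg_zero]

theorem sum_homotopyCoeff (z : A) :
    ∑ c ∈ Finset.range l, left k (F.homotopyCoeff z (c + 1)) * F.U ^ (l - 1 - c) =
      F.homotopy l z * F.U := by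
  have h := Finset.sum_range_sub (fun c => left k (F.homotopyCoeff z c) * F.U ^ (l - c)) l
  rw [hF.homotopyCoeff_self, left_zero, zero_mul, Nat.sub_zero, hF.U_pow_eq_zero, mul_zero,
    sub_self, Finset.sum_sub_distrib, sub_eq_zero] at h
  rw [homotopy, Finset.sum_mul]
  refine Eq.trans (Finset.sum_congr rfl fun c hc => ?_)
    (h.trans (Finset.sum_congr rfl fun c hc => ?_))
  · rw [Nat.sub_sub, add_comm 1 c]
  · have := Finset.mem_range.1 hc
    rw [mul_assoc, ← pow_succ]
    congr 3
    omega

/-- This and `homotopy_mul_sub` say that multiplication by `z t` from `P 1` to `P 0` and the homotopy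
from `P 0` to `P 1` form a chain map of degree one on the periodic complex, whose differentials
alternate between `T - U` and the norm element. -/
theorem sub_mul_homotopy (z : A) :
    (F.T - F.U) * F.homotopy l z = left k (z * F.t) * F.N l := by
  have hT : F.T * F.homotopy l z = F.homotopy l z * F.U + left k (z * F.t) * F.N l := by
    rw [← hF.sum_homotopyCoeff, homotopy, N, Finset.mul_sum, Finset.mul_sum,
      ← Finset.sum_add_distrib]
    refine Finset.sum_congr rfl fun c _ => ?_
    rw [← mul_assoc, ← left_mul, F.t_mul_homotopyCoeff, left_add, add_mul, ← left_pow, ← mul_assoc,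
      ← left_mul, mul_assoc z, ← pow_succ']
  have hU : F.U * F.homotopy l z = F.homotopy l z * F.U := by
    rw [homotopy, Finset.mul_sum, Finset.sum_mul]
    refine Finset.sum_congr rfl fun c _ => ?_
    rw [← mul_assoc, ← (commute_left_right _ _).eq, mul_assoc, mul_assoc, ← pow_succ, ← pow_succ']
  rw [sub_mul, hT, hU, add_sub_cancel_left]

theorem homotopy_mul_sub (z : A) :
    F.homotopy l z * (F.T - F.U) = F.N l * left k (z * F.t) := by
  rw [mul_sub, sub_eq_iff_eq_add', ← hF.sum_homotopyCoeff, homotopy, N, Finset.sum_mul,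
    Finset.sum_mul, ← Finset.sum_add_distrib]
  refine Finset.sum_congr rfl fun c _ => ?_
  rw [mul_assoc, ← (F.commute_T_U.pow_right _).eq, ← mul_assoc, ← left_mul, F.homotopyCoeff_mul_t,
    left_add, add_mul, mul_assoc,
    ← ((commute_left_right (k := k) (z * F.t) F.t).pow_right (l - 1 - c)).eq, ← left_pow,
    ← mul_assoc (left k (F.t ^ c)), ← left_mul]

/-- Evaluated on multiples of `t`, each term of the homotopy contains `l` factors `t`, so that the
product of two classes of degree one is zero. -/
theorem homotopy_smul_toRegular (z y : A) :
    F.homotopy l z • toRegular k (y * F.t) = 0 := by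
  rw [homotopy, Finset.sum_smul]
  refine Finset.sum_eq_zero fun c hc => ?_
  have := Finset.mem_range.1 hc
  rw [mul_smul, ← right_pow, right_smul_toRegular, left_smul_toRegular, mul_assoc y, ← pow_succ',
    homotopyCoeff, Finset.sum_mul, Finset.sum_eq_zero, map_zero]
  intro a ha
  have := Finset.mem_range.1 ha
  obtain ⟨y', hy⟩ := F.exists_t_pow_mul (c - a) y
  rw [neg_mul, mul_assoc, ← mul_assoc (F.t ^ (c - a)), hy, mul_assoc, mul_assoc, ← pow_add,
    ← mul_assoc z, ← mul_assoc, hF.t_pow_mul_mul_t_pow (by omega), neg_zero]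

/-- A cocycle `f : K → A` lifts to a morphism of complexes between the periodic resolution and
its shift which is again periodic. Here `g` is the component `A → K` on the even syzygies,
while `f` is the component on the odd ones. -/
theorem exists_periodic_lift (f : F.K ⟶ regularBimodule k A) :
    ∃ g : regularBimodule k A ⟶ F.K,
      hF.shortExact_S₁.extClass.comp (Ext.mk₀ g) (add_zero 1) =
        (Ext.mk₀ f).comp F.shortExact_S₀.extClass (zero_add 1) ∧
      F.shortExact_S₀.extClass.comp (Ext.mk₀ f) (add_zero 1) =
        (Ext.mk₀ g).comp hF.shortExact_S₁.extClass (zero_add 1) ∧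
      ∀ f' : F.K ⟶ regularBimodule k A, g ≫ f' = 0 := by
  have hE : ∀ f : F.P 1 ⟶ regularBimodule k A,
      F.E 1 • f.hom (gen (F.E 1)) = f.hom (gen (F.E 1)) := fun f => by
    rw [← map_smul, F.E_smul_gen]
  have hval : ∀ f : F.P 1 ⟶ regularBimodule k A, ∃ z,
      f.hom (gen (F.E 1)) = toRegular k (z * F.t) := fun f => by
    obtain ⟨y, hy⟩ := (toRegular k).surjective (f.hom (gen (F.E 1)))
    obtain ⟨z, hz⟩ := hF.exists_E_one_smul y
    exact ⟨z, by rw [← hz, hy, hE]⟩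
  obtain ⟨z, hz⟩ := hval (F.p ≫ f)
  have hEz : F.E 1 • toRegular k (z * F.t) = toRegular k (z * F.t) := by rw [← hz, hE]
  -- the lift `P 1 → P 0` of `f`
  let g₁ : F.P 1 ⟶ F.P 0 := lift (left k (z * F.t) • gen (F.E 0))
  have hE₁ : F.E 1 • left k (z * F.t) • gen (F.E 0) = left k (z * F.t) • gen (F.E 0) := by
    rw [F.E_smul_left_smul_gen]
    rw [F.E_smul_toRegular] at hEz
    rw [(toRegular k).injective hEz]
  have hg₁ : g₁.hom (gen (F.E 1)) = left k (z * F.t) • gen (F.E 0) := lift_gen hE₁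
  have hg₁f : g₁ ≫ F.aug = F.p ≫ f := by
    refine hom_ext ?_
    rw [hz, ModuleCat.hom_comp, LinearMap.comp_apply, hg₁, map_smul, F.aug_gen,
      left_smul_toRegular, mul_one]
  let g : regularBimodule k A ⟶ F.K := F.liftK (hF.j ≫ g₁) (by
    rw [Category.assoc, hg₁f, ← Category.assoc, hF.j_p, Limits.zero_comp])
  have hg : g ≫ F.i = hF.j ≫ g₁ := rfl
  -- the lift `P 0 → P 1` of `g`
  let g₀ : F.P 0 ⟶ F.P 1 := lift (F.E 0 • F.homotopy l z • gen (F.E 1))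
  have hg₀ : g₀.hom (gen (F.E 0)) = F.E 0 • F.homotopy l z • gen (F.E 1) :=
    lift_gen (by rw [← mul_smul, F.E_mul_self])
  have hg₀g : g₀ ≫ F.p = F.aug ≫ g := by
    rw [← cancel_mono F.i, Category.assoc, Category.assoc, F.p_i, hg]
    refine hom_ext ?_
    rw [ModuleCat.hom_comp, LinearMap.comp_apply, hg₀, map_smul, map_smul, F.d_gen, ← mul_smul,
      ← mul_smul, mul_assoc, hF.homotopy_mul_sub, ← mul_assoc, ← hF.N_mul_E_one, mul_smul, mul_smul,
      hE₁, ModuleCat.hom_comp, LinearMap.comp_apply, F.aug_gen, ModuleCat.hom_comp,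
      LinearMap.comp_apply, j_apply, map_smul, map_smul, hg₁]
    exact (one_smul (Enveloping k A) _).symm
  have hfg₀ : f ≫ hF.j = F.i ≫ g₀ := by
    rw [← cancel_epi F.p, ← Category.assoc, ← Category.assoc, F.p_i]
    refine hom_ext ?_
    rw [ModuleCat.hom_comp, LinearMap.comp_apply, hz, ModuleCat.hom_comp, LinearMap.comp_apply,
      F.d_gen, map_smul, hg₀, ← mul_smul, F.sub_mul_E, zero_add, mul_smul,
      ← mul_smul _ (F.homotopy l z), hF.sub_mul_homotopy, mul_smul, ← hF.j_apply, ← map_smul, hEz]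
  refine ⟨g, ?_, ?_, fun f' => ?_⟩
  · exact hF.shortExact_S₁.extClass_naturality F.shortExact_S₀
      { τ₁ := g, τ₂ := g₁, τ₃ := f, comm₁₂ := hg, comm₂₃ := hg₁f }
  · exact F.shortExact_S₀.extClass_naturality hF.shortExact_S₁
      { τ₁ := f, τ₂ := g₀, τ₃ := g, comm₁₂ := hfg₀, comm₂₃ := hg₀g }
  · obtain ⟨z', hz'⟩ := hval (F.p ≫ f')
    rw [← cancel_epi F.aug, ← Category.assoc, ← hg₀g, Category.assoc, Limits.comp_zero]
    refine hom_ext ?_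
    rw [ModuleCat.hom_comp, LinearMap.comp_apply, hg₀, map_smul, map_smul, hz',
      hF.homotopy_smul_toRegular, smul_zero]
    rfl

theorem commute_one_zeta (x : HHdeg k A 1) : Commute (HH.of 1 x) (HH.of 2 hF.zeta) := by
  obtain ⟨f, rfl⟩ := F.shortExact_S₀.exists_extClass_comp_mk₀ x
  obtain ⟨g, hg, hg', -⟩ := hF.exists_periodic_lift f
  refine HH.commute_of (r := 3) rfl rfl ?_
  rw [hF.zeta_comp _ _ (rfl : 1 + 1 = 2) rfl, Ext.comp_assoc _ _ _ (add_zero 1) (zero_add 2) rfl]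
  congr 1
  rw [zeta, ← Ext.comp_assoc _ _ _ (zero_add 1) rfl rfl, ← hg,
    Ext.comp_assoc _ _ _ (add_zero 1) (zero_add 1) rfl, ← hg']

theorem one_mul_one (x y : HHdeg k A 1) : HH.of 1 x * HH.of 1 y = 0 := by
  obtain ⟨f, rfl⟩ := F.shortExact_S₀.exists_extClass_comp_mk₀ x
  obtain ⟨f', rfl⟩ := F.shortExact_S₀.exists_extClass_comp_mk₀ y
  obtain ⟨g, hg, -, hg'⟩ := hF.exists_periodic_lift f'
  rw [HH.of_mul_of, Ext.comp_assoc _ _ _ (add_zero 1) (zero_add 1) rfl,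
    ← Ext.comp_assoc _ _ _ (zero_add 1) (add_zero 1) rfl, ← hg,
    Ext.comp_assoc _ _ _ (add_zero 1) (add_zero 0) rfl, Ext.mk₀_comp_mk₀,
    show g ≫ f = 0 from hg' f, Ext.mk₀_zero, Ext.comp_zero, Ext.comp_zero, map_zero]

theorem commute_center_zeta (z : Subalgebra.center k A) :
    Commute (HH.of 0 (centerClass z)) (HH.of 2 hF.zeta) := by
  refine HH.commute_of (r := 2) rfl rfl ?_
  rw [hF.zeta_comp _ _ (rfl : 1 + 0 = 1) rfl, zeta, centerClass, ← centralEnd_regularBimodule,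
    ← Ext.comp_assoc _ _ _ (zero_add 1) rfl rfl]
  have h₀ := extClass_comp_centralEnd z F.shortExact_S₀
  have h₁ := extClass_comp_centralEnd z hF.shortExact_S₁
  rw [← h₀, h₁, Ext.comp_assoc _ _ _ (add_zero 1) (zero_add 1) rfl]

end IsTruncated

theorem commute_center_one (F : CyclicFrame k n A) (z : Subalgebra.center k A)
    (x : HHdeg k A 1) :
    Commute (HH.of 0 (centerClass z)) (HH.of 1 x) := by
  obtain ⟨f, rfl⟩ := F.shortExact_S₀.exists_extClass_comp_mk₀ x
  refine HH.commute_of (r := 1) rfl rfl ?_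
  rw [centerClass, ← centralEnd_regularBimodule, Ext.comp_assoc _ _ _ (add_zero 1) (add_zero 0) rfl,
    Ext.mk₀_comp_mk₀, ← centralEnd_naturality, ← Ext.mk₀_comp_mk₀]
  have h₀ := extClass_comp_centralEnd z F.shortExact_S₀
  rw [← Ext.comp_assoc _ _ _ (zero_add 1) (add_zero 1) rfl, ← h₀,
    Ext.comp_assoc _ _ _ (add_zero 1) (add_zero 0) rfl]

end CyclicFrame

/-! ### The cyclic frames of the crown algebras -/

namespace CyclicFrame

variable {k : Type u} [Field k] {n : ℕ} [NeZero n] {A : Type u} [Ring A] [Algebra k A]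

/-- The image of a cyclic frame under a surjective morphism of algebras. -/
def map (F : CyclicFrame k n A) {B : Type u} [Ring B] [Algebra k B] (φ : A →ₐ[k] B)
    (hφ : Function.Surjective φ) : CyclicFrame k n B where
  e i := φ (F.e i)
  t := φ F.t
  e_mul_e i j := by
    rw [← map_mul, F.e_mul_e]
    split_ifs
    · rfl
    · rw [map_zero]
  sum_e := by rw [← map_sum, F.sum_e, map_one]
  t_mul_e i := by rw [← map_mul, F.t_mul_e, map_mul]
  mem_span b := by
    obtain ⟨a, rfl⟩ := hφ b
    induction F.mem_span a using Submodule.span_induction with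
    | mem x hx =>
      obtain ⟨p, rfl⟩ := hx
      exact Submodule.subset_span ⟨p, by rw [map_mul, map_pow]⟩
    | zero => rw [map_zero]; exact zero_mem _
    | add x y _ _ hx hy => rw [map_add]; exact add_mem hx hy
    | smul r x _ hx => rw [map_smul]; exact Submodule.smul_mem _ _ hx

theorem t_pow_mul_comm (F : CyclicFrame k n A) {l : ℕ} (hl : (l : ZMod n) = 0) (a : A) :
    F.t ^ l * a = a * F.t ^ l := by
  induction F.mem_span a using Submodule.span_induction with
  | mem x hx =>
    obtain ⟨⟨i, b⟩, rfl⟩ := hx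
    dsimp only
    rw [← mul_assoc, F.t_pow_mul_e, hl, add_zero, mul_assoc, mul_assoc, ← pow_add, ← pow_add,
      add_comm]
  | zero => rw [mul_zero, zero_mul]
  | add x y _ _ hx hy => rw [mul_add, add_mul, hx, hy]
  | smul r x _ hx => rw [mul_smul_comm, smul_mul_assoc, hx]

end CyclicFrame

namespace Crown

variable (k : Type u) [Field k] (n : ℕ) [NeZero n]

/-- The trivial path at a vertex. -/
def e (i : Crown n) : PathAlgebra k (Crown n) := PathAlgebra.ofPath k ⟨i, i, Quiver.Path.nil⟩

theorem t_mul_ofPath {a b : Crown n} (p : Quiver.Path a b) :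
    t k n * PathAlgebra.ofPath k ⟨a, b, p⟩ =
      PathAlgebra.ofPath k ⟨a, b.next, p.cons (arrow b)⟩ := by
  rw [t, Finset.sum_mul, Finset.sum_eq_single b]
  · rw [PathAlgebra.ofPath_mul_ofPath, PathAlgebra.mulPath, dif_pos rfl]
    rfl
  · intro c _ hc
    rw [PathAlgebra.ofPath_mul_ofPath, PathAlgebra.mulPath, dif_neg (Ne.symm hc)]
  · simp

theorem ofPath_eq {a b : Crown n} (p : Quiver.Path a b) :
    PathAlgebra.ofPath k ⟨a, b, p⟩ = t k n ^ p.length * e k n a := by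
  induction p with
  | nil => rw [Quiver.Path.length_nil, pow_zero, one_mul, e]
  | cons p f ih =>
    obtain ⟨rfl⟩ := f
    rw [Quiver.Path.length_cons, pow_succ', mul_assoc, ← ih, t_mul_ofPath]
    rfl

theorem exists_ofPath_eq (i : Crown n) (b : ℕ) : ∃ p : QuiverPath (Crown n),
    p.1 = i ∧ p.2.1 = ((show ZMod n from i) + (b : ZMod n) : ZMod n) ∧ p.2.2.length = b ∧
      PathAlgebra.ofPath k p = t k n ^ b * e k n i := by
  induction b with
  | zero =>
    refine ⟨⟨i, i, Quiver.Path.nil⟩, rfl, ?_, rfl, (one_mul _).symm⟩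
    rw [Nat.cast_zero]
    exact (add_zero (show ZMod n from i)).symm
  | succ b ih =>
    obtain ⟨⟨a, c, p⟩, h₁, h₂, h₃, h₄⟩ := ih
    refine ⟨⟨a, c.next, p.cons (arrow c)⟩, h₁, ?_, congrArg (· + 1) h₃, ?_⟩
    · rw [Nat.cast_succ, ← add_assoc, ← h₂]
      rfl
    · rw [← t_mul_ofPath, h₄, pow_succ', mul_assoc]

theorem e_mul_e (i j : Crown n) : e k n i * e k n j = if i = j then e k n i else 0 := by
  rw [e, e, PathAlgebra.ofPath_mul_ofPath, PathAlgebra.mulPath]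
  by_cases h : i = j
  · subst h
    simp
  · rw [dif_neg (Ne.symm h), if_neg h]

theorem t_mul_e (i : Crown n) : t k n * e k n i = e k n i.next * t k n := by
  rw [e, t_mul_ofPath, t, Finset.mul_sum, Finset.sum_eq_single i]
  · rw [e, PathAlgebra.ofPath_mul_ofPath, PathAlgebra.mulPath, dif_pos rfl]
    rfl
  · intro j _ hj
    rw [e, PathAlgebra.ofPath_mul_ofPath, PathAlgebra.mulPath, dif_neg]
    intro h
    exact hj (add_right_cancel (G := ZMod n) h)
  · simp

theorem ofPath_eq' {a b : Crown n} (p : Quiver.Path a b) :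
    PathAlgebra.ofPath k ⟨a, b, p⟩ = e k n b * t k n ^ p.length := by
  induction p with
  | nil => rw [Quiver.Path.length_nil, pow_zero, mul_one, e]
  | cons p f ih =>
    obtain ⟨rfl⟩ := f
    rw [Quiver.Path.length_cons, pow_succ', ← mul_assoc, ← t_mul_e, mul_assoc, ← ih, t_mul_ofPath]
    rfl

/-- The cyclic frame of the path algebra, formed by the trivial paths and the sum of all arrows. -/
def pathFrame : CyclicFrame k n (PathAlgebra k (Crown n)) where
  e := e k n
  t := t k n
  e_mul_e i j := (e_mul_e k n i j).trans (by congr)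
  sum_e := rfl
  t_mul_e := t_mul_e k n
  mem_span a := by
    induction a using PathAlgebra.induction_ofPath with
    | h0 => exact zero_mem _
    | hadd f g hf hg => exact add_mem hf hg
    | hsingle r p => exact Submodule.smul_mem _ _ (Submodule.subset_span
        ⟨(p.2.1, p.2.2.length), (ofPath_eq' k n p.2.2).symm⟩)

/-- The sum of the coefficients of the paths of length `b` that end at `i`. -/
def coeff (i : Crown n) (b : ℕ) : PathAlgebra k (Crown n) →ₗ[k] k :=
  Finsupp.linearCombination k fun p : QuiverPath (Crown n) =>
    if p.2.1 = i ∧ p.2.2.length = b then 1 else 0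

theorem coeff_ofPath (i : Crown n) (b : ℕ) (p : QuiverPath (Crown n)) :
    coeff k n i b (PathAlgebra.ofPath k p) =
      if p.2.1 = i ∧ p.2.2.length = b then 1 else 0 :=
  (Finsupp.linearCombination_single _ _ _).trans (one_smul _ _)

theorem coeff_e_mul_t_pow (i : Crown n) (b : ℕ) (i' : Crown n) (b' : ℕ) :
    coeff k n i b (e k n i' * t k n ^ b') = if i' = i ∧ b' = b then 1 else 0 := by
  obtain ⟨j, hj⟩ : ∃ j : Crown n, i' = ((show ZMod n from j) + (b' : ZMod n) : ZMod n) :=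
    ⟨((show ZMod n from i') - (b' : ZMod n) : ZMod n),
      (sub_add_cancel (show ZMod n from i') (b' : ZMod n)).symm⟩
  obtain ⟨p, -, h₂, h₃, h₄⟩ := exists_ofPath_eq k n j b'
  have h : t k n ^ b' * e k n j = e k n i' * t k n ^ b' := by
    rw [hj]
    exact (pathFrame k n).t_pow_mul_e b' j
  rw [← h, ← h₄, coeff_ofPath]
  exact if_congr (and_congr (Eq.congr_left (h₂.trans hj.symm)) (Eq.congr_left h₃)) rfl rfl

theorem pathFrame_hasCoeff (b : ℕ) : (pathFrame k n).HasCoeff b := fun i =>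
  ⟨coeff k n i b, fun i' b' => (coeff_e_mul_t_pow k n i b i' b').trans (by congr)⟩

variable {n} {l : ℕ}

/-- As `t ^ l` is central, the ideal it generates consists of its left multiples. -/
theorem exists_eq_mul_t_pow (hl : (l : ZMod n) = 0) {x : PathAlgebra k (Crown n)}
    (hx : x ∈ ideal k n l) : ∃ a, x = a * t k n ^ l := by
  have hc : ∀ a, t k n ^ l * a = a * t k n ^ l := (pathFrame k n).t_pow_mul_comm hl
  have := TwoSidedIdeal.mem_span_iff.1 (TwoSidedIdeal.mem_asIdeal.1 hx)
    (TwoSidedIdeal.mk' {x | ∃ a, x = a * t k n ^ l} ⟨0, (zero_mul _).symm⟩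
      (by rintro _ _ ⟨a, rfl⟩ ⟨b, rfl⟩; exact ⟨a + b, (add_mul _ _ _).symm⟩)
      (by rintro _ ⟨a, rfl⟩; exact ⟨-a, (neg_mul _ _).symm⟩)
      (by rintro x _ ⟨a, rfl⟩; exact ⟨x * a, (mul_assoc _ _ _).symm⟩)
      (by rintro _ y ⟨a, rfl⟩; exact ⟨a * y, by rw [mul_assoc, mul_assoc, hc]⟩))
    (by
      rintro _ rfl
      rw [SetLike.mem_coe, TwoSidedIdeal.mem_mk']
      exact ⟨1, (one_mul _).symm⟩)
  rwa [TwoSidedIdeal.mem_mk'] at this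

variable (n l) in
theorem proj_surjective : Function.Surjective (proj k n l) := Ideal.Quotient.mkₐ_surjective _ _

variable (n l) in
theorem proj_eq_zero_iff {x : PathAlgebra k (Crown n)} :
    proj k n l x = 0 ↔ x ∈ ideal k n l := Ideal.Quotient.eq_zero_iff_mem

variable (n l) in
/-- A `k`-linear section of the projection. -/
theorem exists_section : ∃ τ : Truncated k n l →ₗ[k] PathAlgebra k (Crown n),
    ∀ x, proj k n l (τ x) = x := by
  obtain ⟨τ, hτ⟩ := (proj k n l).toLinearMap.exists_rightInverse_of_surjective
    (LinearMap.range_eq_top.2 (proj_surjective k n l))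
  exact ⟨τ, fun x => LinearMap.congr_fun hτ x⟩

variable (n l) in
/-- The cyclic frame of the truncated algebra. -/
def truncatedFrame : CyclicFrame k n (Truncated k n l) :=
  (pathFrame k n).map (proj k n l) (proj_surjective k n l)

theorem truncatedFrame_isTruncated (hn : 2 ≤ n) (hl : (l : ZMod n) = 0) (hl0 : 0 < l) :
    (truncatedFrame k n l).IsTruncated l where
  one_ne_zero := by
    have : Fact (1 < n) := ⟨hn⟩
    exact one_ne_zero
  pos := hl0
  t_pow := by
    refine (map_pow (proj k n l) _ _).symm.trans ((proj_eq_zero_iff k n l).2 ?_)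
    exact TwoSidedIdeal.mem_asIdeal.2 (TwoSidedIdeal.subset_span rfl)
  natCast_eq_zero := hl
  hasCoeff b hb i := by
    obtain ⟨τ, hτ⟩ := exists_section k n l
    have h0 : ∀ x ∈ ideal k n l, coeff k n i b x = 0 := by
      intro x hx
      obtain ⟨a, rfl⟩ := exists_eq_mul_t_pow k hl hx
      clear hx
      induction (pathFrame k n).mem_span a using Submodule.span_induction with
      | mem x hx =>
        obtain ⟨⟨i', b'⟩, rfl⟩ := hx
        dsimp only
        have := coeff_e_mul_t_pow k n i b i' (b' + l)
        rw [pow_add, ← mul_assoc, if_neg (by omega)] at this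
        exact this
      | zero => rw [zero_mul, map_zero]
      | add x y _ _ hx hy => rw [add_mul, map_add, hx, hy, add_zero]
      | smul r x _ hx => rw [smul_mul_assoc, map_smul, hx, smul_zero]
    refine ⟨coeff k n i b ∘ₗ τ, fun i' b' => ?_⟩
    have hx : ∀ x, (coeff k n i b ∘ₗ τ) (proj k n l x) = coeff k n i b x := fun x => by
      rw [LinearMap.comp_apply, ← sub_eq_zero, ← map_sub]
      refine h0 _ ((proj_eq_zero_iff k n l).1 ?_)
      rw [map_sub, hτ, sub_self]
    have h : (truncatedFrame k n l).e i' * (truncatedFrame k n l).t ^ b' =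
        proj k n l ((pathFrame k n).e i' * (pathFrame k n).t ^ b') := by
      rw [map_mul, map_pow]
      rfl
    rw [h]
    exact ((hx _).trans (coeff_e_mul_t_pow k n i b i' b')).trans (by congr)

end Crown

/-! ### The class of the singular extension -/

namespace CyclicFrame

variable {k : Type u} [Field k] {n : ℕ} [NeZero n] {A : Type u} [Ring A] [Algebra k A]
variable (F : CyclicFrame k n A)

/-- The Leibniz rule for the derivation with `t ↦ E 1`, on powers of `t`. -/
theorem N_add (b c : ℕ) : F.N (b + c) = F.T ^ b * F.N c + F.U ^ c * F.N b := by
  rw [N, Finset.sum_range_add, add_comm, N, N, Finset.mul_sum, Finset.mul_sum]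
  congr 1
  · refine Finset.sum_congr rfl fun a ha => ?_
    rw [pow_add, mul_assoc]
    congr 3
    omega
  · refine Finset.sum_congr rfl fun a ha => ?_
    have := Finset.mem_range.1 ha
    rw [← mul_assoc, ← ((F.commute_T_U.pow_left a).pow_right c).eq, mul_assoc, ← pow_add]
    congr 2
    omega

theorem left_e_mul_right_e_mul_N (i j : ZMod n) (c : ℕ) :
    left k (F.e i) * (right k (F.e j) * F.N c * F.E 1) =
      if i = j + c then right k (F.e j) * F.N c * F.E 1 else 0 := by
  rw [mul_assoc (right k (F.e j)), F.N_mul_E, ← mul_assoc (right k (F.e j)), F.right_e_mul_E,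
    ← mul_assoc, ← mul_assoc, ← left_mul, F.e_mul_e]
  split_ifs with h
  · rw [h]
  · rw [left_zero, zero_mul, zero_mul]

end CyclicFrame

namespace Crown

open CyclicFrame cyclicModule

variable (k : Type u) [Field k] (n : ℕ) [NeZero n] (l : ℕ)

/-- The derivation from the path algebra to the bimodule `P 1` of the truncated algebra, regarded
as a part of the enveloping algebra, that maps `t` to the generator `E 1` and vanishes on the
trivial paths. -/
def derivation : PathAlgebra k (Crown n) →ₗ[k] Enveloping k (Truncated k n l) :=
  Finsupp.linearCombination k fun p : QuiverPath (Crown n) =>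
    right k ((truncatedFrame k n l).e p.1) * (truncatedFrame k n l).N p.2.2.length *
      (truncatedFrame k n l).E 1

theorem derivation_t_pow_mul_e (b : ℕ) (i : ZMod n) :
    derivation k n l ((pathFrame k n).t ^ b * (pathFrame k n).e i) =
      right k ((truncatedFrame k n l).e i) * (truncatedFrame k n l).N b *
        (truncatedFrame k n l).E 1 := by
  obtain ⟨p, h₁, -, h₃, h₄⟩ := exists_ofPath_eq k n i b
  refine (congrArg (derivation k n l) h₄.symm).trans ?_
  rw [← h₁, ← h₃]
  exact (Finsupp.linearCombination_single _ _ _).trans (one_smul _ _)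

variable {k n} in
theorem induction_t_pow {P : PathAlgebra k (Crown n) → Prop} (f : PathAlgebra k (Crown n))
    (h0 : P 0) (hadd : ∀ f g, P f → P g → P (f + g)) (hsmul : ∀ (r : k) f, P f → P (r • f))
    (ht : ∀ (b : ℕ) (i : ZMod n), P ((pathFrame k n).t ^ b * (pathFrame k n).e i)) : P f := by
  induction f using PathAlgebra.induction_ofPath with
  | h0 => exact h0
  | hadd f g hf hg => exact hadd f g hf hg
  | hsingle r p =>
    refine hsmul r _ ?_
    obtain ⟨a, b, p⟩ := p
    rw [ofPath_eq]
    exact ht _ _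

variable {k n} in
theorem left_truncated (b : ℕ) (i : ZMod n) :
    left k (proj k n l ((pathFrame k n).t ^ b * (pathFrame k n).e i)) =
      (truncatedFrame k n l).T ^ b * left k ((truncatedFrame k n l).e i) := by
  rw [map_mul, left_mul, map_pow, left_pow]
  rfl

variable {k n} in
theorem right_truncated (b : ℕ) (i : ZMod n) :
    right k (proj k n l ((pathFrame k n).t ^ b * (pathFrame k n).e i)) =
      right k ((truncatedFrame k n l).e i) * (truncatedFrame k n l).U ^ b := by
  rw [map_mul, right_mul, map_pow, right_pow]
  rfl

/-- The Leibniz rule. -/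
theorem derivation_mul (x y : PathAlgebra k (Crown n)) :
    derivation k n l (x * y) = left k (proj k n l x) * derivation k n l y +
      right k (proj k n l y) * derivation k n l x := by
  have hls : ∀ (r : k) (x : Truncated k n l), left k (r • x) = r • left k x := fun r x =>
    (TensorProduct.smul_tmul' _ _ _).symm
  have hrs : ∀ (r : k) (x : Truncated k n l), right k (r • x) = r • right k x := fun r x =>
    TensorProduct.tmul_smul r (1 : Truncated k n l) (MulOpposite.op x)
  induction x using induction_t_pow with
  | h0 => simp only [zero_mul, map_zero, left_zero, mul_zero, add_zero]
  | hadd f g hf hg =>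
    rw [add_mul, map_add, hf, hg, map_add, map_add, left_add, add_mul, mul_add, add_add_add_comm]
  | hsmul r f hf =>
    rw [smul_mul_assoc, map_smul, hf, map_smul, map_smul, hls, smul_mul_assoc, mul_smul_comm,
      smul_add]
  | ht b i =>
    induction y using induction_t_pow with
    | h0 => simp only [mul_zero, map_zero, right_zero, zero_mul, add_zero]
    | hadd f g hf hg =>
      rw [mul_add, map_add, hf, hg, map_add, map_add, right_add, add_mul, mul_add,
        add_add_add_comm]
    | hsmul r f hf =>
      rw [mul_smul_comm, map_smul, hf, map_smul, map_smul, hrs, smul_mul_assoc, mul_smul_comm,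
        smul_add]
    | ht c j =>
      have hyx : right k (proj k n l ((pathFrame k n).t ^ c * (pathFrame k n).e j)) *
          right k ((truncatedFrame k n l).e i) = right k (proj k n l ((pathFrame k n).e i *
            ((pathFrame k n).t ^ c * (pathFrame k n).e j))) := by
        rw [map_mul (proj k n l) ((pathFrame k n).e i), right_mul]
        rfl
      rw [mul_assoc ((pathFrame k n).t ^ b), left_truncated, derivation_t_pow_mul_e,
        derivation_t_pow_mul_e, mul_assoc (_ ^ b), left_e_mul_right_e_mul_N,
        mul_assoc (right k ((truncatedFrame k n l).e i)), ← mul_assoc (right k (proj k n l _)), hyx]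
      split_ifs with h
      · have hij : (pathFrame k n).e i * ((pathFrame k n).t ^ c * (pathFrame k n).e j) =
            (pathFrame k n).t ^ c * (pathFrame k n).e j := by
          rw [t_pow_mul_e, ← mul_assoc, h, e_mul_self]
        rw [hij, ← mul_assoc, ← pow_add, derivation_t_pow_mul_e, N_add, right_truncated, mul_add,
          add_mul]
        congr 1
        · rw [← mul_assoc, ← mul_assoc, ← mul_assoc,
            ((commute_left_right (k := k) (truncatedFrame k n l).t
              ((truncatedFrame k n l).e j)).pow_left b).eq]
        · simp only [mul_assoc]
      · have hij : (pathFrame k n).e i * ((pathFrame k n).t ^ c * (pathFrame k n).e j) = 0 := by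
          rw [t_pow_mul_e, ← mul_assoc, CyclicFrame.e_mul_e, if_neg h, zero_mul]
        simp only [hij, mul_zero, map_zero, right_zero, zero_mul, add_zero]

/-- The composite with the differential `P 1 → P 0` is the inner derivation `x ↦ x E 0 - E 0 x`. -/
theorem derivation_mul_sub (x : PathAlgebra k (Crown n)) :
    derivation k n l x * ((truncatedFrame k n l).T - (truncatedFrame k n l).U) =
      left k (proj k n l x) * (truncatedFrame k n l).E 0 -
        right k (proj k n l x) * (truncatedFrame k n l).E 0 := by
  induction x using induction_t_pow with
  | h0 => rw [map_zero, map_zero, zero_mul, left_zero, right_zero, sub_self]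
  | hadd f g hf hg =>
    rw [map_add, map_add, add_mul, hf, hg, left_add, right_add, add_mul, add_mul, add_sub_add_comm]
  | hsmul r f hf =>
    have hr : ∀ x : Enveloping k (Truncated k n l),
        r • x = left k (algebraMap k (Truncated k n l) r) * x := fun x => Algebra.smul_def r x
    rw [map_smul, map_smul, hr, mul_assoc, hf, right_smul, Algebra.smul_def, left_mul, mul_sub,
      mul_assoc, mul_assoc]
  | ht b i =>
    have h0 : right k ((truncatedFrame k n l).e i) * (truncatedFrame k n l).E 0 =
        left k ((truncatedFrame k n l).e i) * (truncatedFrame k n l).E 0 := by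
      have := (truncatedFrame k n l).left_e_mul_E i 0
      rw [add_zero i] at this
      rw [this, right_e_mul_E, add_zero]
    have hE := (truncatedFrame k n l).sub_mul_E 0
    rw [zero_add] at hE
    rw [derivation_t_pow_mul_e, mul_assoc, ← hE, ← mul_assoc, mul_assoc (right k _), N_mul_sub,
      mul_sub, left_truncated, right_truncated, sub_mul, mul_assoc (_ ^ b), ← h0,
      ← mul_assoc (_ ^ b), ((commute_left_right (k := k) (truncatedFrame k n l).t
        ((truncatedFrame k n l).e i)).pow_left b).eq]

variable {k n l}

theorem derivation_t_pow (b : ℕ) :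
    derivation k n l ((pathFrame k n).t ^ b) =
      (truncatedFrame k n l).N b * (truncatedFrame k n l).E 1 := by
  have h : ∑ i, right k ((truncatedFrame k n l).e i) = 1 := by
    refine (TensorProduct.tmul_sum _ _ _).symm.trans ?_
    rw [← Finset.op_sum, (truncatedFrame k n l).sum_e]
    rfl
  rw [← mul_one ((pathFrame k n).t ^ b), ← (pathFrame k n).sum_e, Finset.mul_sum, map_sum]
  simp_rw [derivation_t_pow_mul_e, mul_assoc]
  rw [← Finset.sum_mul]
  exact (congrArg (· * _) h).trans (one_mul _)

/-- On the ideal generated by `t ^ l`, the derivation takes values in the copy of `B` generated by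
the norm element. This relates the factor set of `kQ/I^2` to the periodic resolution. -/
theorem derivation_mul_t_pow (hF : (truncatedFrame k n l).IsTruncated l)
    (x : PathAlgebra k (Crown n)) :
    derivation k n l (x * (pathFrame k n).t ^ l) = left k (proj k n l x) *
      ((truncatedFrame k n l).N l * (truncatedFrame k n l).E 1) := by
  have h : right k (proj k n l ((pathFrame k n).t ^ l)) = 0 := by
    rw [map_pow, right_pow]
    exact hF.U_pow_eq_zero
  rw [derivation_mul, derivation_t_pow, h, zero_mul, add_zero]

theorem derivation_mul_E (x : PathAlgebra k (Crown n)) :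
    derivation k n l x * (truncatedFrame k n l).E 1 = derivation k n l x := by
  induction x using induction_t_pow with
  | h0 => rw [map_zero, zero_mul]
  | hadd f g hf hg => rw [map_add, add_mul, hf, hg]
  | hsmul r f hf => rw [map_smul, smul_mul_assoc, hf]
  | ht b i => rw [derivation_t_pow_mul_e, mul_assoc, E_mul_self]

/-- The class of the periodic resolution is the class of `0 → B → kQ/I^2 → B → 0`: a section `τ` of
the projection `kQ → B`, composed with the derivation, is the component of degree one of a
morphism from the standard resolution. -/
theorem isSingularExtensionClass_zeta (hF : (truncatedFrame k n l).IsTruncated l) :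
    IsSingularExtensionClass (squareProj k n l)
      (M := regularBimodule k (Truncated k n l)) (theta k n l) hF.zeta := by
  obtain ⟨τ, hτ⟩ := exists_section k n l
  have hker : ∀ a b, ∃ x, τ a * τ b - τ (a * b) = x * (pathFrame k n).t ^ l := fun a b => by
    refine exists_eq_mul_t_pow k hF.natCast_eq_zero ((proj_eq_zero_iff k n l).1 ?_)
    rw [map_sub, map_mul, hτ, hτ, hτ, sub_self]
  choose c hc using hker
  let F := truncatedFrame k n l
  have hval : ∀ (r : Enveloping k (Truncated k n l)) (x : PathAlgebra k (Crown n)),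
      val (r • derivation k n l x • gen (F.E 1)) = r * derivation k n l x := fun r x => by
    rw [← mul_smul, val_smul_gen, mul_assoc, derivation_mul_E]
  have hval' : ∀ x : PathAlgebra k (Crown n),
      val (derivation k n l x • gen (F.E 1)) = derivation k n l x := fun x => by
    rw [val_smul_gen, derivation_mul_E]
  refine ⟨(toSquareQuotient k n l).toLinearMap ∘ₗ τ, fun a b => toRegular k (proj k n l (c a b)),
    fun a => ?_, fun a b => ?_, F.K, F.P 0, F.P 1, F.i, F.aug, F.i_aug, F.shortExact_S₀, hF.j, F.p,
    hF.j_p, hF.shortExact_S₁, gen (F.E 0),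
    ((LinearMap.toSpanSingleton _ (F.P 1) (gen (F.E 1))).toAddMonoidHom.comp
      (derivation k n l).toAddMonoidHom).comp τ.toAddMonoidHom, F.aug_gen, fun r a => ?_,
    fun a => ?_, fun a b => ?_, rfl⟩
  · exact (squareProj_toSquareQuotient k n l (τ a)).trans (hτ a)
  · refine (theta_proj k n l (c a b)).trans ((congrArg (toSquareQuotient k n l)
      (hc a b).symm).trans ?_)
    rw [map_sub, map_mul]
    rfl
  · refine val_injective ?_
    change val (derivation k n l (τ (r • a)) • gen (F.E 1)) =
      val (algebraMap k (Enveloping k (Truncated k n l)) r • derivation k n l (τ a) • gen (F.E 1))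
    rw [hval, hval', map_smul, map_smul]
    exact Algebra.smul_def r (derivation k n l (τ a))
  · refine val_injective ?_
    change val (F.d.hom (derivation k n l (τ a) • gen (F.E 1))) =
      val (left k a • gen (F.E 0) - right k a • gen (F.E 0))
    rw [F.val_d, hval', derivation_mul_sub, hτ, map_sub, val_smul_gen, val_smul_gen]
  · refine val_injective ?_
    change val (left k (proj k n l (c a b)) • F.N l • gen (F.E 1)) =
      val (left k a • derivation k n l (τ b) • gen (F.E 1) -
        derivation k n l (τ (a * b)) • gen (F.E 1) +
          right k b • derivation k n l (τ a) • gen (F.E 1))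
    have h := derivation_mul k n l (τ a) (τ b)
    rw [hτ, hτ] at h
    rw [map_add, map_sub, hval, hval, hval', sub_add_eq_add_sub, ← h, ← map_sub, hc,
      derivation_mul_t_pow hF, ← mul_smul, val_smul_gen, mul_assoc]

end Crown

/-! ### Comparison of the first cohomology groups -/

namespace CyclicFrame.IsTruncated

variable {k : Type u} [Field k] {n : ℕ} [NeZero n] {A : Type u} [Ring A] [Algebra k A]
variable {F : CyclicFrame k n A} {l : ℕ} (hF : F.IsTruncated l)
include hF

theorem exists_p_comp_eq (f : F.P 1 ⟶ regularBimodule k A) : ∃ g, F.p ≫ g = f := by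
  have : Epi hF.S₁.g := inferInstanceAs (Epi F.p)
  exact ⟨hF.shortExact_S₁.exact.desc f (hF.j_comp_eq_zero f), hF.shortExact_S₁.exact.g_desc f _⟩

end CyclicFrame.IsTruncated

namespace Crown

open CyclicFrame cyclicModule

variable (k : Type u) [Field k] (n : ℕ) [NeZero n] (l : ℕ)

/-- The morphism of enveloping algebras induced by the projection `kQ → B`. -/
abbrev envelopingProj :
    Enveloping k (PathAlgebra k (Crown n)) →ₐ[k] Enveloping k (Truncated k n l) :=
  Algebra.TensorProduct.map (proj k n l) (AlgHom.op (proj k n l))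

theorem envelopingProj_left (a : PathAlgebra k (Crown n)) :
    envelopingProj k n l (left k a) = left k (proj k n l a) := by
  refine (Algebra.TensorProduct.map_tmul _ _ _ _).trans ?_
  rw [map_one]; rfl

theorem envelopingProj_right (a : PathAlgebra k (Crown n)) :
    envelopingProj k n l (right k a) = right k (proj k n l a) := by
  refine (Algebra.TensorProduct.map_tmul _ _ _ _).trans ?_
  rw [map_one]; rfl

theorem envelopingProj_E (j : ZMod n) :
    envelopingProj k n l ((pathFrame k n).E j) = (truncatedFrame k n l).E j := by
  rw [E, map_sum]
  refine Finset.sum_congr rfl fun i _ => ?_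
  rw [map_mul, envelopingProj_left, envelopingProj_right]; rfl

theorem envelopingProj_sub :
    envelopingProj k n l ((pathFrame k n).T - (pathFrame k n).U) =
      (truncatedFrame k n l).T - (truncatedFrame k n l).U := by
  rw [map_sub, T, U, envelopingProj_left, envelopingProj_right]; rfl

variable {k n l}

/-- Derivations modulo inner derivations from `kQ` or from `B` to `B` are described by the same
values at `t`, so that `H^1(kQ, B)` is isomorphic to `HH^1(B)`. -/
theorem exists_H1_equiv (hF : (truncatedFrame k n l).IsTruncated l) :
    ∃ ψ : H1 k n l ≃+ HHdeg k (Truncated k n l) 1,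
      ∀ (z : Subalgebra.center k (Truncated k n l)) (h : H1 k n l),
        HH.of 1 (ψ (z • h)) = HH.of 0 (centerClass z) * HH.of 1 (ψ h) := by
  obtain ⟨κ, hκ, hκc, hκ0⟩ := (truncatedFrame k n l).exists_extOne_presentation
    (truncatedFrame k n l).shortExact_S₀ (truncatedFrame k n l).p (truncatedFrame k n l).p_i
    (M := regularBimodule k (Truncated k n l)) hF.exists_p_comp_eq
  obtain ⟨κ', hκ', hκc', hκ0'⟩ := (pathFrame k n).exists_extOne_presentation
    ((pathFrame k n).shortExact_d_aug (pathFrame_hasCoeff k n)) (𝟙 _) (Category.id_comp _)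
    (M := (restrictBimodule k (proj k n l)).obj (regularBimodule k (Truncated k n l)))
    fun f => ⟨f, Category.id_comp f⟩
  let κ₁ : regularBimodule k (Truncated k n l) →+ H1 k n l := κ'
  have hκ₁ : Function.Surjective κ₁ := hκ'
  have hker : κ₁.ker = κ.ker := by
    ext y
    refine (hκ0' y).trans (Iff.trans ?_ (hκ0 y).symm)
    refine exists_congr fun x => ?_
    rw [← envelopingProj_E, ← envelopingProj_sub]
    rfl
  obtain ⟨ψ, hψ⟩ : ∃ ψ : H1 k n l ≃+ HHdeg k (Truncated k n l) 1, ∀ y, ψ (κ₁ y) = κ y := by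
    refine ⟨(QuotientAddGroup.quotientKerEquivOfSurjective κ₁ hκ₁).symm.trans
      ((QuotientAddGroup.quotientAddEquivOfEq hker).trans
        (QuotientAddGroup.quotientKerEquivOfSurjective κ hκ)), fun y => ?_⟩
    have : (QuotientAddGroup.quotientKerEquivOfSurjective κ₁ hκ₁).symm (κ₁ y) =
        QuotientAddGroup.mk y := (AddEquiv.symm_apply_eq _).2 rfl
    rw [AddEquiv.trans_apply, this]
    rfl
  refine ⟨ψ, fun z h => ?_⟩
  obtain ⟨y, rfl⟩ := hκ₁ h
  have hz : z • κ₁ y = κ₁ ((centerEnd z).hom y) :=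
    hκc' ((restrictBimodule k (proj k n l)).map (centerEnd z)) y
  rw [hz, hψ, hψ, HH.of_mul_of, ← hκc (centerEnd z) y]
  rfl

end Crown

end

theorem mainTheorem12 {k : Type u} [Field k] (n m : ℕ) [NeZero n] (hn : 2 ≤ n) (hm : 1 ≤ m) :
    ∃ ζ : HHdeg k (Crown.Truncated k n (n * m)) 2,
      IsSingularExtensionClass (Crown.squareProj k n (n * m))
        (M := regularBimodule k (Crown.Truncated k n (n * m))) (Crown.theta k n (n * m)) ζ ∧
      ∃ (Φ : (Subalgebra.center k (Crown.Truncated k n (n * m)))[X] ≃ₐ[k]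
            HHeven k (Crown.Truncated k n (n * m)))
        (Ψ : PolynomialModule (Subalgebra.center k (Crown.Truncated k n (n * m)))
            (Crown.H1 k n (n * m)) ≃+ HHodd k (Crown.Truncated k n (n * m))),
        (Φ X : HH k (Crown.Truncated k n (n * m))) = HH.of 2 ζ ∧
        (∀ z, (Φ (C z) : HH k (Crown.Truncated k n (n * m))) = HH.of 0 (centerClass z)) ∧
        (∀ p v, Ψ (p • v) = Φ p • Ψ v) ∧
        (∀ h, ∃ x, (Ψ (PolynomialModule.single _ 0 h) : HH k (Crown.Truncated k n (n * m))) =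
          HH.of 1 x) ∧
        (∀ x ∈ HHodd k (Crown.Truncated k n (n * m)),
          ∀ y ∈ HHodd k (Crown.Truncated k n (n * m)), x * y = 0) ∧
        ∃ Θ : HH k (Crown.Truncated k n (n * m)) ≃+
            (Subalgebra.center k (Crown.Truncated k n (n * m)))[X] ×
              PolynomialModule (Subalgebra.center k (Crown.Truncated k n (n * m)))
                (Crown.H1 k n (n * m)),
          (∀ p v, Θ ((Φ p : HH k (Crown.Truncated k n (n * m))) + Ψ v) = (p, v)) ∧
          ∀ x y, Θ (x * y) =
            ((Θ x).1 * (Θ y).1, (Θ x).1 • (Θ y).2 + (Θ y).1 • (Θ x).2) := by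
  have hF := Crown.truncatedFrame_isTruncated k (l := n * m) hn (by simp)
    (Nat.mul_pos (by omega) hm)
  obtain ⟨ψ, hψ⟩ := Crown.exists_H1_equiv hF
  exact ⟨hF.zeta, Crown.isSingularExtensionClass_zeta hF, HH.periodic_structure hF.zeta
    hF.mulRightTwo_zeta_bijective centerClass_bijective hF.commute_center_zeta hF.commute_one_zeta
    (Crown.truncatedFrame k n (n * m)).commute_center_one hF.one_mul_one ψ hψ⟩
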